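/- Let $p$ and $p_1$ be primes, let $m\ge 1$ be an integer and put $N=p_1^m$. Assume that $\gcd(p(p-1),N)=1$ and that $-1\notin\langle p\rangle$, where $\langle p\rangle$ is the subgroup of $(\mathbb Z/N\mathbb Z)^*$ generated by $p$. Let $f$ be the order of $p$ modulo $N$, let $w=[(\mathbb Z/N\mathbb Z)^*:\langle p\rangle]$, and assume that $w\mid p_1-1$. Put $q=p^f$, let $\gamma$ be a primitive element of $\mathbb F_q$, and define $$C_i=\Big\{\gamma^{i+jN} : 0\le j\le \tfrac{q-1}{N}-1\Big\},\qquad D=\bigcup_{i=0}^{p_1^{m-1}-1} C_i .$$ Let $\mathrm{Cay}(\mathbb F_q,D)$ be the graph with vertex set $\mathbb F_q$ in which $x,y$ are adjacent if and only if $x-y\in D$. An eigenvalue of (the adjacency matrix of) a graph is called restricted if it has an eigenvector orthogonal to the all-one vector. Let $\xi_p,\xi_N,\xi_{p_1}\in\mathbb C$ be primitive roots of unity of orders $p$, $N$, $p_1$, let $\psi(x)=\xi_p^{\mathrm{Tr}_{q/p}(x)}$, let $\theta$ be the multiplicative character of $\mathbb F_q$ with $\theta(\gamma)=\xi_N$,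 and let $g(\overline\theta)=\sum_{a\in\mathbb F_q^*}\theta^{-1}(a)\psi(a)$. Let $K$ be the decomposition field of $p$ in $\mathbb Q(\xi_N)$ (the fixed field of the automorphism $\xi_N\mapsto\xi_N^p$) and $O_K$ its ring of integers. Let $h$ be a primitive root modulo $p_1$, and for $0\le j\le w-1$ let $\eta_j=\sum_{a}\xi_{p_1}^a$, where $a$ runs over the coset $h^j\langle p\rangle$ of the subgroup generated by $p$ in $(\mathbb Z/p_1\mathbb Z)^*$. Then: 1. $-D=D$ and $0\notin D$, and $\mathrm{Cay}(\mathbb F_q,D)$ is an undirected loopless regular graph of valency $|D|$. 2. $\mathrm{Cay}(\mathbb F_q,D)$ has at most $w+1$ distinct restricted eigenvalues. 3. There is a largest integer $r\ge 0$ with $p^{-r}g(\overline\theta)\in O_K$; there are unique integers $N_0,\dots,N_{w-1}$ with $$g(\overline\theta)=p^r\,(N_0\eta_0+N_1\eta_1+\cdots+N_{w-1}\eta_{w-1});$$ and, with $M_0=N_0+\cdots+N_{w-1}$, the set of restricted eigenvalues of $\mathrm{Cay}(\mathbb F_q,D)$ is $$\left\{\tfrac1{p_1}\Big(-1+\tfrac{1-p_1}{w}p^rM_0\Big)\right\}\cup\left\{\tfrac1{p_1}\Big(-1+\tfrac{1-p_1}{w}p^rM_0\Big)+p^rN_i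 : 0\le i\le w-1\right\}.$$ -/

import Mathlib

open scoped Classical

noncomputable section

/-- The subgroup `⟨p⟩` of `(ℤ/nℤ)ˣ` generated by the residue class of `p`
(meant for `p` coprime to `n`). -/
def residueSubgroup (n p : ℕ) : Subgroup (ZMod n)ˣ :=
  Subgroup.closure {u : (ZMod n)ˣ | (u : ZMod n) = (p : ZMod n)}

/-- The cyclotomic class `C_i = {γ^(i + jN) : 0 ≤ j ≤ (q-1)/N - 1}` of the finite field `F`
of order `q`. -/
def cyclotomicClass {F : Type*} [Field F] (γ : F) (N i : ℕ) : Set F :=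
  {x | ∃ j : ℕ, j < (Nat.card F - 1) / N ∧ x = γ ^ (i + j * N)}

/-- The connection set `D = ⋃_{0 ≤ i < p₁^(m-1)} C_i`, with cyclotomic classes of order
`N = p₁^m`. -/
def connectionSet {F : Type*} [Field F] (γ : F) (p₁ m : ℕ) : Set F :=
  {x | ∃ i : ℕ, i < p₁ ^ (m - 1) ∧ x ∈ cyclotomicClass γ (p₁ ^ m) i}

/-- A real number is a restricted eigenvalue of a finite graph if it is an eigenvalue of its
adjacency matrix that has an eigenvector orthogonal to the all-one vector. -/
def IsRestrictedEigenvalue {V : Type*} [Fintype V] (G : SimpleGraph V) (μ : ℝ) : Prop :=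
  ∃ v : V → ℝ, Module.End.HasEigenvector (Matrix.toLin' (G.adjMatrix ℝ)) μ v ∧
    v ⬝ᵥ (fun _ => (1 : ℝ)) = 0

/-- The canonical additive character `ψ(x) = ξ_p^{Tr(x)}` of a finite field `F` of
characteristic `p`, where `Tr` is the trace from `F` to the prime field. -/
def canonicalAddChar {p : ℕ} [NeZero p] (F : Type*) [Field F] [Algebra (ZMod p) F]
    {ξp : ℂ} (hξp : ξp ^ p = 1) : AddChar F ℂ :=
  (AddChar.zmodChar p hξp).compAddMonoidHom (Algebra.trace (ZMod p) F).toAddMonoidHom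

/-- The Gauss period `η_j = ∑ ξ^a`, where `a` runs over the coset `g^j⟨p⟩` of `(ℤ/p₁ℤ)ˣ` and `ξ`
is a complex primitive `p₁`-th root of unity. -/
def gaussPeriod (p₁ p : ℕ) [NeZero p₁] (g : (ZMod p₁)ˣ) (ξ : ℂ) (j : ℕ) : ℂ :=
  ∑ a : (ZMod p₁)ˣ with ∃ h ∈ residueSubgroup p₁ p, a = g ^ j * h, ξ ^ (a : ZMod p₁).val

/-- The cyclotomic field `ℚ(ξ_N)` inside `ℂ`. -/
def cyclotomicSubfield (N : ℕ) : IntermediateField ℚ ℂ :=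
  IntermediateField.adjoin ℚ {z : ℂ | z ^ N = 1}

/-- The decomposition field `K` of a prime `p ∤ N` in `ℚ(ξ_N)`: the fixed field of the subgroup of
`Gal(ℚ(ξ_N)/ℚ)` generated by the automorphism that maps every `N`-th root of unity to its `p`-th
power. -/
def decompositionField (N p : ℕ) : IntermediateField ℚ ℂ :=
  IntermediateField.lift (IntermediateField.fixedField
    (Subgroup.closure {σ : cyclotomicSubfield N ≃ₐ[ℚ] cyclotomicSubfield N |
      ∀ z : cyclotomicSubfield N, z ^ N = 1 → σ z = z ^ p}))

/-- The exponent of the largest power of `p` dividing `z` in the ring of integers `O_K` of the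
decomposition field `K` of `p` in `ℚ(ξ_N)` is `r`: `r` is the largest `k` with `p^(-k) z ∈ O_K`. -/
def IsLargestExponent (N p : ℕ) (z : ℂ) (r : ℕ) : Prop :=
  IsGreatest {k : ℕ | z / (p : ℂ) ^ k ∈ decompositionField N p ∧
    IsIntegral ℤ (z / (p : ℂ) ^ k)} r

end

/-! Additive characters diagonalise the graph, so the restricted eigenvalues are the sums of `ψ (b *
x)` over `x ∈ D` with `b ≠ 0` (`isRestrictedEigenvalue_addCayley_iff`). Expanding the indicator of
`D` in powers of `θ` (`sum_connectionSet`) turns `N` times such a sum into a combination of the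
Gauss sums of `θ⁻¹ ^ t`, `0 ≤ t < N`. Because `D` consists of `p₁^(m-1)` consecutive classes, the
terms with `p₁ ∣ t`, `t ≠ 0` cancel; the other nonzero `t` give Galois conjugates of `g(θ̄)`.

Since `gcd(p - 1, N) = 1`, `θ` is trivial on the prime field, which puts `g(θ̄)` in `ℚ(ξ_N)`
(`sub_one_mul_gaussSum`), and Frobenius invariance puts it in `K` (`gaussSum_pow_char`). As `w` is
prime to `p₁`, `⟨p⟩` contains every residue that is 1 mod `p₁`. Hence integers of `K` are integral
combinations of the nontrivial `p₁`-th roots of unity, with unique coefficients `C` constant on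
cosets of `⟨p⟩` (`exists_invariant_unit_coeff`); these are the `N_i`.

Inserting this expansion, the sum over `t` becomes an orthogonality relation (`sum_sum_pow_mul_eq`).
It selects the one pair `(i, u)` with `θ(b) ξ_N^i ξ_{p₁}^u = 1` (`exists_unique_root_relation`), so
the eigenvalue is a constant, plus `p^r C(u)` when `u ≠ 0`. Every `u` mod `p₁` occurs. -/

/-! ### Cayley graphs of finite abelian groups -/

lemma addCayley_adj_iff_sub_mem {A : Type*} [AddCommGroup A] {S : Set A}
    (hneg : ∀ x, -x ∈ S ↔ x ∈ S) (h0 : (0 : A) ∉ S) (x y : A) :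
    (SimpleGraph.addCayley S).Adj x y ↔ x - y ∈ S := by
  rw [SimpleGraph.addCayley_adj']
  constructor
  · rintro ⟨-, s, hs, h | h⟩
    · rw [← h]
      simpa [hneg] using hs
    · rw [h]
      simpa using hs
  · intro h
    refine ⟨?_, x - y, h, Or.inr (by abel)⟩
    rintro rfl
    simp [h0] at h

lemma neighborFinset_addCayley {A : Type*} [AddCommGroup A] [Fintype A] {S : Set A}
    (hneg : ∀ x, -x ∈ S ↔ x ∈ S) (h0 : (0 : A) ∉ S) (x : A)
    [Fintype ((SimpleGraph.addCayley S).neighborSet x)] :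
    (SimpleGraph.addCayley S).neighborFinset x = S.toFinset.image (fun s => x - s) := by
  ext y
  simp only [SimpleGraph.mem_neighborFinset, addCayley_adj_iff_sub_mem hneg h0,
    Finset.mem_image, Set.mem_toFinset]
  constructor
  · intro h
    exact ⟨x - y, h, by abel⟩
  · rintro ⟨s, hs, rfl⟩
    simpa using hs

lemma isRegularOfDegree_addCayley {A : Type*} [AddCommGroup A] [Fintype A] {S : Set A}
    (hneg : ∀ x, -x ∈ S ↔ x ∈ S) (h0 : (0 : A) ∉ S) :
    (SimpleGraph.addCayley S).IsRegularOfDegree S.ncard := by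
  intro x
  rw [← SimpleGraph.card_neighborFinset_eq_degree, neighborFinset_addCayley hneg h0,
    Finset.card_image_of_injective _ (sub_right_injective), Set.ncard_eq_toFinset_card']

lemma adjMatrix_addCayley_mulVec {A : Type*} [AddCommGroup A] [Fintype A] {S : Set A}
    {_ : DecidableRel (SimpleGraph.addCayley S).Adj}
    (hneg : ∀ x, -x ∈ S ↔ x ∈ S) (h0 : (0 : A) ∉ S) (v : A → ℝ) (x : A) :
    ((SimpleGraph.addCayley S).adjMatrix ℝ).mulVec v x = ∑ s ∈ S.toFinset, v (x - s) := by
  rw [SimpleGraph.adjMatrix_mulVec_apply, neighborFinset_addCayley hneg h0,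
    Finset.sum_image (fun _ _ _ _ h => sub_right_injective h)]

/-! ### Restricted spectrum through additive characters -/

section Spectrum

variable {F : Type*} [Field F] [Fintype F] {ψ : AddChar F ℂ} {S : Set F}

/-- Fourier inversion: summing the transform against `ψ (-a * y)` recovers `|F| * v y`. -/
lemma eq_zero_of_fourier_eq_zero (hψ : ψ.IsPrimitive) (v : F → ℂ)
    (h : ∀ a, ∑ x, v x * ψ (a * x) = 0) : v = 0 := by
  funext y
  have h1 : ∑ a, (∑ x, v x * ψ (a * x)) * ψ (a * (-y)) = 0 := by simp [h]
  simp_rw [Finset.sum_mul, mul_assoc, ← AddChar.map_add_eq_mul, ← mul_add] at h1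
  rw [Finset.sum_comm] at h1
  simp_rw [← Finset.mul_sum, AddChar.sum_mulShift _ hψ, ← sub_eq_add_neg, sub_eq_zero] at h1
  simpa using h1

lemma isRestrictedEigenvalue_addCayley_iff (hψ : ψ.IsPrimitive)
    (hneg : ∀ x, -x ∈ S ↔ x ∈ S) (h0 : (0 : F) ∉ S) (μ : ℝ) :
    IsRestrictedEigenvalue (SimpleGraph.addCayley S) μ ↔
      ∃ a : F, a ≠ 0 ∧ (μ : ℂ) = ∑ s ∈ S.toFinset, ψ (a * s) := by
  constructor
  · rintro ⟨v, hv, hv1⟩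
    by_contra! hcon
    refine hv.2 ?_
    have hAv : ∀ x, ∑ s ∈ S.toFinset, v (x - s) = μ * v x := fun x => by
      have h := congrFun hv.apply_eq_smul x
      rwa [Matrix.toLin'_apply, adjMatrix_addCayley_mulVec hneg h0] at h
    have hv' : (fun x => (v x : ℂ)) = 0 := by
      refine eq_zero_of_fourier_eq_zero hψ _ fun a => ?_
      by_cases ha : a = 0
      · subst ha
        simp only [zero_mul, AddChar.map_zero_eq_one, mul_one]
        rw [← Complex.ofReal_sum]
        have := hv1
        simp only [dotProduct, mul_one] at this
        rw [this, Complex.ofReal_zero]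
      -- The adjacency operator is a convolution, so on the Fourier side it multiplies by the
      -- character sum over `S`. If `μ` is none of these sums, every coefficient of `v` vanishes.
      · have key : (μ : ℂ) * ∑ x, (v x : ℂ) * ψ (a * x) =
            (∑ s ∈ S.toFinset, ψ (a * s)) * ∑ x, (v x : ℂ) * ψ (a * x) := by
          calc (μ : ℂ) * ∑ x, (v x : ℂ) * ψ (a * x)
              = ∑ x, ∑ s ∈ S.toFinset, (v (x - s) : ℂ) * ψ (a * x) := by
                rw [Finset.mul_sum]
                refine Finset.sum_congr rfl fun x _ => ?_
                rw [← mul_assoc, ← Complex.ofReal_mul, ← hAv, Complex.ofReal_sum, Finset.sum_mul]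
            _ = ∑ s ∈ S.toFinset, ∑ x, (v x : ℂ) * ψ (a * (x + s)) := by
                rw [Finset.sum_comm]
                refine Finset.sum_congr rfl fun s _ => ?_
                exact Fintype.sum_equiv (Equiv.subRight s) _ _ fun x => by simp
            _ = _ := by
                rw [Finset.sum_mul]
                refine Finset.sum_congr rfl fun s _ => ?_
                rw [Finset.mul_sum]
                refine Finset.sum_congr rfl fun x _ => ?_
                rw [mul_add, AddChar.map_add_eq_mul]
                ring
        by_contra hne
        exact hcon a ha (mul_right_cancel₀ hne key)
    funext x
    exact Complex.ofReal_eq_zero.mp (congrFun hv' x)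
  · rintro ⟨a, ha, hμ⟩
    -- As `μ` is real, the real part of the complex eigenvector is again one; it is nonzero because
    -- its value at 0 is 1.
    refine ⟨fun x => (ψ (a * x)).re, ⟨?_, ?_⟩, ?_⟩
    · rw [Module.End.mem_eigenspace_iff]
      funext x
      rw [Matrix.toLin'_apply, adjMatrix_addCayley_mulVec hneg h0, ← Complex.re_sum]
      have : ∑ s ∈ S.toFinset, ψ (a * (x - s)) = μ * ψ (a * x) := by
        rw [hμ, Finset.sum_mul]
        refine Finset.sum_bij' (fun s _ => -s) (fun s _ => -s) ?_ ?_ ?_ ?_ ?_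
        · simp [hneg]
        · simp [hneg]
        · simp
        · simp
        · intro s _
          rw [← AddChar.map_add_eq_mul]
          congr 1
          ring
      rw [this, Complex.re_ofReal_mul]
      simp
    · intro h
      simpa using congrFun h 0
    · simp only [dotProduct, mul_one]
      rw [← Complex.re_sum]
      have := AddChar.sum_eq_zero_of_ne_one (hψ ha)
      simp only [AddChar.mulShift_apply] at this
      rw [this, Complex.zero_re]

end Spectrum

/-! ### Subgroups generated by a residue class -/

lemma residueSubgroup_eq_zpowers {n p : ℕ} (h : p.Coprime n) :
    residueSubgroup n p = Subgroup.zpowers (ZMod.unitOfCoprime p h) := by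
  rw [residueSubgroup, Subgroup.zpowers_eq_closure]
  congr 1
  ext u
  simp [Units.ext_iff]

lemma exists_pow_of_mem_residueSubgroup {n p : ℕ} [NeZero n] (h : p.Coprime n) {u : (ZMod n)ˣ}
    (hu : u ∈ residueSubgroup n p) : ∃ k : ℕ, (u : ZMod n) = (p : ZMod n) ^ k := by
  rw [residueSubgroup_eq_zpowers h, ← mem_powers_iff_mem_zpowers] at hu
  obtain ⟨k, rfl⟩ := hu
  exact ⟨k, by simp⟩

lemma map_residueSubgroup {n d p : ℕ} (h : p.Coprime n) (hd : d ∣ n) :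
    (residueSubgroup n p).map (ZMod.unitsMap hd) = residueSubgroup d p := by
  rw [residueSubgroup_eq_zpowers h, residueSubgroup_eq_zpowers (h.coprime_dvd_right hd),
    MonoidHom.map_zpowers]
  congr 1
  ext
  simp [ZMod.unitsMap_def]

/-- Each `q`-th power of an element congruent to 1 mod `q` gains one more factor `q` in the
congruence. -/
lemma pow_eq_one_of_unitsMap_eq_one {q m : ℕ} (hm : 1 ≤ m) [NeZero q]
    (u : (ZMod (q ^ m))ˣ) (hu : ZMod.unitsMap (dvd_pow_self q (by omega : m ≠ 0)) u = 1) :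
    u ^ q ^ (m - 1) = 1 := by
  have hval : (((u : ZMod (q ^ m)).val : ℤ) : ZMod (q ^ m)) = u := by simp
  have h1 : ((q : ℕ) : ℤ) ∣ ((u : ZMod (q ^ m)).val : ℤ) - 1 := by
    rw [← Int.modEq_iff_dvd, ← ZMod.intCast_eq_intCast_iff]
    have := congrArg (fun v : (ZMod q)ˣ => (v : ZMod q)) hu
    simp only [ZMod.unitsMap_val, Units.val_one] at this
    rw [Int.cast_one, ← this, ZMod.cast_eq_val, Int.cast_natCast]
  have h2 := dvd_sub_pow_of_dvd_sub h1 (m - 1)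
  rw [show m - 1 + 1 = m by omega, one_pow, ← Nat.cast_pow q m,
    ← Int.modEq_iff_dvd] at h2
  have h3 := (ZMod.intCast_eq_intCast_iff 1 _ (q ^ m)).mpr h2
  ext
  push_cast at h3 ⊢
  simpa using h3.symm

/-- The image of `u` in the quotient by `⟨p⟩` has order dividing both a power of `q` and the index,
which are coprime. -/
lemma ker_unitsMap_le_residueSubgroup {q m p : ℕ} (hm : 1 ≤ m) [NeZero q]
    (hw : ((residueSubgroup (q ^ m) p).index).Coprime q) (u : (ZMod (q ^ m))ˣ)
    (hu : ZMod.unitsMap (dvd_pow_self q (by omega : m ≠ 0)) u = 1) :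
    u ∈ residueSubgroup (q ^ m) p := by
  rw [← QuotientGroup.eq_one_iff]
  have h1 : (u : (ZMod (q ^ m))ˣ ⧸ residueSubgroup (q ^ m) p) ^ (q ^ (m - 1)) = 1 := by
    rw [← QuotientGroup.mk_pow, pow_eq_one_of_unitsMap_eq_one hm u hu, QuotientGroup.mk_one]
  have h2 : (u : (ZMod (q ^ m))ˣ ⧸ residueSubgroup (q ^ m) p) ^
      (residueSubgroup (q ^ m) p).index = 1 := by
    rw [← QuotientGroup.mk_pow, QuotientGroup.eq_one_iff]
    exact Subgroup.pow_index_mem _ u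
  have h3 := pow_gcd_eq_one.mpr ⟨h1, h2⟩
  rwa [(hw.symm.pow_left (m - 1)).gcd_eq_one, pow_one] at h3

lemma index_residueSubgroup_eq {q m p : ℕ} (hm : 1 ≤ m) [NeZero q] (hp : p.Coprime (q ^ m))
    (hw : ((residueSubgroup (q ^ m) p).index).Coprime q) :
    (residueSubgroup q p).index = (residueSubgroup (q ^ m) p).index := by
  have hd : q ∣ q ^ m := dvd_pow_self q (by omega)
  rw [← map_residueSubgroup hp hd, Subgroup.index_map,
    MonoidHom.range_eq_top.mpr (ZMod.unitsMap_surjective hd), Subgroup.index_top, mul_one,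
    sup_eq_left.mpr]
  intro u hu
  exact ker_unitsMap_le_residueSubgroup hm hw u hu

/-! ### Galois action on the cyclotomic field -/

lemma isCyclotomicExtension_cyclotomicSubfield (N : ℕ) [NeZero N] :
    IsCyclotomicExtension {N} ℚ (cyclotomicSubfield N) := by
  have h := IntermediateField.isCyclotomicExtension_adjoin_of_exists_isPrimitiveRoot {N} ℚ ℂ
    (fun n hn hn0 => ⟨_, Complex.isPrimitiveRoot_exp n hn0⟩)
  have : {b : ℂ | ∃ n ∈ ({N} : Set ℕ), n ≠ 0 ∧ b ^ n = 1} = {z : ℂ | z ^ N = 1} := by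
    ext b
    simp [NeZero.ne N]
  rwa [this] at h

lemma mem_cyclotomicSubfield {N : ℕ} {z : ℂ} (hz : z ^ N = 1) : z ∈ cyclotomicSubfield N :=
  IntermediateField.subset_adjoin ℚ _ hz

lemma exists_algEquiv_pow {N k : ℕ} [NeZero N] (hk : k.Coprime N) :
    ∃ σ : cyclotomicSubfield N ≃ₐ[ℚ] cyclotomicSubfield N,
      ∀ z : cyclotomicSubfield N, z ^ N = 1 → σ z = z ^ k := by
  have := isCyclotomicExtension_cyclotomicSubfield N
  have hζ := IsCyclotomicExtension.zeta_spec N ℚ (cyclotomicSubfield N)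
  refine ⟨IsCyclotomicExtension.fromZetaAut (hζ.pow_of_coprime k hk)
    (Polynomial.cyclotomic.irreducible_rat (NeZero.pos N)), fun z hz => ?_⟩
  obtain ⟨i, -, rfl⟩ := hζ.eq_pow_of_pow_eq_one hz
  rw [map_pow, IsCyclotomicExtension.fromZetaAut_spec, pow_right_comm]

lemma mem_decompositionField_iff {N p : ℕ} {z : ℂ} :
    z ∈ decompositionField N p ↔ ∃ h : z ∈ cyclotomicSubfield N,
      ∀ σ : cyclotomicSubfield N ≃ₐ[ℚ] cyclotomicSubfield N,
        (∀ x : cyclotomicSubfield N, x ^ N = 1 → σ x = x ^ p) → σ ⟨z, h⟩ = ⟨z, h⟩ := by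
  constructor
  · intro h
    have h' : z ∈ cyclotomicSubfield N := IntermediateField.lift_le _ h
    refine ⟨h', fun σ hσ => ?_⟩
    exact (IntermediateField.mem_fixedField_iff _ _).mp
      ((IntermediateField.mem_lift (⟨z, h'⟩ : cyclotomicSubfield N)).mp h) σ
      (Subgroup.subset_closure hσ)
  · rintro ⟨h, hσ⟩
    refine (IntermediateField.mem_lift (⟨z, h⟩ : cyclotomicSubfield N)).mpr ?_
    rw [IntermediateField.mem_fixedField_iff]
    intro σ hmem
    have hle : Subgroup.closure {σ : cyclotomicSubfield N ≃ₐ[ℚ] cyclotomicSubfield N |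
        ∀ z : cyclotomicSubfield N, z ^ N = 1 → σ z = z ^ p} ≤
        MulAction.stabilizer (cyclotomicSubfield N ≃ₐ[ℚ] cyclotomicSubfield N)
          (⟨z, h⟩ : cyclotomicSubfield N) := by
      rw [Subgroup.closure_le]
      intro τ hτ
      exact MulAction.mem_stabilizer_iff.mpr (hσ τ hτ)
    exact MulAction.mem_stabilizer_iff.mp (hle hmem)

/-- An element of the decomposition field of `p` is fixed by the automorphisms raising the
`N`-th roots of unity to a power in `⟨p⟩`. -/
lemma exists_algEquiv_pow_fixing {N p : ℕ} [NeZero N] (hp : p.Coprime N) {z : ℂ}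
    (hz : z ∈ decompositionField N p) (k : ℕ) :
    ∃ σ : cyclotomicSubfield N ≃ₐ[ℚ] cyclotomicSubfield N,
      (∀ x : cyclotomicSubfield N, x ^ N = 1 → σ x = x ^ p ^ k) ∧
      ∀ y : cyclotomicSubfield N, (y : ℂ) = z → σ y = y := by
  obtain ⟨h, hfix⟩ := mem_decompositionField_iff.mp hz
  obtain ⟨σ, hσ⟩ := exists_algEquiv_pow hp
  have hσz : ∀ y : cyclotomicSubfield N, (y : ℂ) = z → σ y = y := by
    rintro y rfl
    exact hfix σ hσ
  induction k with
  | zero => exact ⟨AlgEquiv.refl, by simp, by simp⟩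
  | succ k ih =>
    obtain ⟨τ, h1, h2⟩ := ih
    refine ⟨τ.trans σ, fun x hx => ?_, fun y hy => ?_⟩
    · rw [AlgEquiv.trans_apply, h1 x hx, map_pow, hσ x hx, ← pow_mul, pow_succ']
    · rw [AlgEquiv.trans_apply, h2 y hy, hσz y hy]

lemma pow_eq_pow_of_natCast_eq {R : Type*} [Monoid R] {n a b : ℕ} {x : R} (hx : x ^ n = 1)
    (h : (a : ZMod n) = b) : x ^ a = x ^ b := by
  rw [pow_eq_pow_mod a hx, pow_eq_pow_mod b hx, (ZMod.natCast_eq_natCast_iff' a b n).mp h]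

/-! ### Integral elements of the decomposition field -/

/-- Dividing the relation by `ξ` leaves a polynomial in `ξ` of degree below `q - 1`, the degree of
the minimal polynomial. -/
lemma unit_coeff_eq_zero_of_sum_eq_zero {q : ℕ} [Fact q.Prime] {ξ : ℂ} (hξ : IsPrimitiveRoot ξ q)
    (C : (ZMod q)ˣ → ℤ) (h : ∑ a : (ZMod q)ˣ, (C a : ℂ) * ξ ^ (a : ZMod q).val = 0) : C = 0 := by
  have hq : q.Prime := Fact.out
  have hpos : ∀ a : (ZMod q)ˣ, 1 ≤ (a : ZMod q).val := fun a =>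
    Nat.one_le_iff_ne_zero.mpr (by simp)
  set P : Polynomial ℤ := ∑ a : (ZMod q)ˣ, Polynomial.monomial ((a : ZMod q).val - 1) (C a) with hP
  have hroot : Polynomial.aeval ξ P = 0 := by
    have h0 : ξ * Polynomial.aeval ξ P = 0 := by
      rw [← h, hP, map_sum, Finset.mul_sum]
      refine Finset.sum_congr rfl fun a _ => ?_
      rw [Polynomial.aeval_monomial]
      nth_rewrite 2 [← Nat.sub_add_cancel (hpos a)]
      rw [pow_succ, eq_intCast]
      ring
    exact (mul_eq_zero.mp h0).resolve_left (hξ.ne_zero hq.ne_zero)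
  have hdvd : Polynomial.cyclotomic q ℤ ∣ P := by
    rw [Polynomial.cyclotomic_eq_minpoly hξ hq.pos]
    exact minpoly.isIntegrallyClosed_dvd (hξ.isIntegral hq.pos) hroot
  have hP0 : P = 0 := by
    refine Polynomial.eq_zero_of_dvd_of_degree_lt hdvd ?_
    rw [Polynomial.degree_cyclotomic, Nat.totient_prime hq]
    refine (Polynomial.degree_sum_le _ _).trans_lt ?_
    rw [Finset.sup_lt_iff (WithBot.bot_lt_coe _)]
    intro a _
    refine (Polynomial.degree_monomial_le _ _).trans_lt ?_
    have := ZMod.val_lt (a : ZMod q)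
    have := hpos a
    exact_mod_cast (by omega : (a : ZMod q).val - 1 < q - 1)
  funext b
  have hb := congrArg (fun Q => Polynomial.coeff Q ((b : ZMod q).val - 1)) hP0
  simp only [hP, Polynomial.finsetSum_coeff, Polynomial.coeff_monomial, Polynomial.coeff_zero] at hb
  rw [Finset.sum_eq_single b] at hb
  · simpa using hb
  · intro a _ hab
    rw [if_neg]
    intro h
    have := hpos a
    have := hpos b
    exact hab (Units.ext (ZMod.val_injective q (by omega)))
  · simp

lemma mem_span_unit_pow_of_pow_eq_one {q : ℕ} [Fact q.Prime] {ξ : ℂ} (hξ : IsPrimitiveRoot ξ q)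
    {z : ℂ} (hz : z ^ q = 1) :
    z ∈ Submodule.span ℤ (Set.range fun a : (ZMod q)ˣ => ξ ^ (a : ZMod q).val) := by
  have hq : q.Prime := Fact.out
  have hmem : ∀ i, i + 1 < q →
      ξ ^ (i + 1) ∈ Submodule.span ℤ (Set.range fun a : (ZMod q)ˣ => ξ ^ (a : ZMod q).val) := by
    intro i hi
    refine Submodule.subset_span ⟨Units.mk0 ((i + 1 : ℕ) : ZMod q) ?_, ?_⟩
    · rw [Ne, ZMod.natCast_eq_zero_iff]
      exact Nat.not_dvd_of_pos_of_lt i.succ_pos hi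
    · simp only [Units.val_mk0, ZMod.val_natCast_of_lt hi]
  obtain ⟨i, hi, rfl⟩ := hξ.eq_pow_of_pow_eq_one hz
  rcases i with _ | i
  · have h := hξ.geom_sum_eq_zero hq.one_lt
    obtain ⟨k, hk⟩ : ∃ k, q = k + 1 := ⟨q - 1, by have := hq.pos; omega⟩
    have h' : ∑ i ∈ Finset.range (k + 1), ξ ^ i = 0 := by rwa [← hk]
    rw [Finset.sum_range_succ'] at h'
    rw [eq_neg_of_add_eq_zero_right h']
    refine Submodule.neg_mem _ (Submodule.sum_mem _ fun j hj => hmem j ?_)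
    have := Finset.mem_range.mp hj
    omega
  · exact hmem i hi

/-- Averaging over exponents congruent to 1 mod `q` is a projector onto the `q`-th roots of unity.
-/
lemma sum_pow_one_add_mul {R : Type*} [CommRing R] [IsDomain R] {x : R} {q n : ℕ}
    (hx : x ^ (q * n) = 1) :
    ∑ s ∈ Finset.range n, x ^ (1 + q * s) = (n : R) * if x ^ q = 1 then x else 0 := by
  simp_rw [pow_add, pow_mul, pow_one, ← Finset.mul_sum]
  split_ifs with h
  · simp [h, mul_comm]
  · have h1 := geom_sum_mul (x ^ q) n
    rw [← pow_mul, hx, sub_self] at h1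
    rw [(mul_eq_zero.mp h1).resolve_right (sub_ne_zero.mpr h)]
    simp

/-- Write `z` as an integral polynomial in `ζ` and average over the automorphisms `ζ ↦ ζ^(1 + q s)`,
all of which fix `z`. Only monomials that are `q`-th roots of unity survive, with unchanged integer
coefficients. -/
lemma mem_span_of_isIntegral_of_mem_decompositionField {q m p : ℕ} [Fact q.Prime] (hm : 1 ≤ m)
    (hp : p.Coprime (q ^ m)) (hw : ((residueSubgroup (q ^ m) p).index).Coprime q)
    {ξ : ℂ} (hξ : IsPrimitiveRoot ξ q) {z : ℂ} (hz : z ∈ decompositionField (q ^ m) p)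
    (hint : IsIntegral ℤ z) :
    z ∈ Submodule.span ℤ (Set.range fun a : (ZMod q)ˣ => ξ ^ (a : ZMod q).val) := by
  have hq : q.Prime := Fact.out
  obtain ⟨hzL, -⟩ := mem_decompositionField_iff.mp hz
  have hcyc := isCyclotomicExtension_cyclotomicSubfield (q ^ m)
  obtain ⟨y, hy⟩ : ∃ y : cyclotomicSubfield (q ^ m), (y : ℂ) = z := ⟨⟨z, hzL⟩, rfl⟩
  have hyint : IsIntegral ℤ y := by
    rw [← hy] at hint
    exact (isIntegral_algHom_iff ((cyclotomicSubfield (q ^ m)).val.restrictScalars ℤ)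
      Subtype.val_injective).mp hint
  have hζ := IsCyclotomicExtension.zeta_spec (q ^ m) ℚ (cyclotomicSubfield (q ^ m))
  set ζ := IsCyclotomicExtension.zeta (q ^ m) ℚ (cyclotomicSubfield (q ^ m)) with hζdef
  -- The ring of integers of a prime power cyclotomic field is `ℤ[ζ]`.
  have hadj : y ∈ Algebra.adjoin ℤ ({ζ} : Set (cyclotomicSubfield (q ^ m))) := by
    have := IsCyclotomicExtension.Rat.isIntegralClosure_adjoin_singleton_of_prime_pow hζ
    obtain ⟨x, hx⟩ := (IsIntegralClosure.isIntegral_iff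
      (A := Algebra.adjoin ℤ ({ζ} : Set (cyclotomicSubfield (q ^ m))))).mp hyint
    rw [← hx]
    exact x.2
  rw [Algebra.adjoin_singleton_eq_range_aeval] at hadj
  obtain ⟨P, hP⟩ := hadj
  have hPy : y = ∑ t ∈ P.support, (P.coeff t : cyclotomicSubfield (q ^ m)) * ζ ^ t := by
    rw [← hP]
    change Polynomial.aeval ζ P = _
    rw [Polynomial.aeval_def, Polynomial.eval₂_eq_sum, Polynomial.sum_def]
    simp
  have hNpos : q * q ^ (m - 1) = q ^ m := by rw [← pow_succ', Nat.sub_add_cancel hm]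
  have hσ : ∀ s : ℕ, y = ∑ t ∈ P.support,
      (P.coeff t : cyclotomicSubfield (q ^ m)) * (ζ ^ t) ^ (1 + q * s) := by
    intro s
    have hcop : (1 + q * s).Coprime (q ^ m) := by
      refine Nat.Coprime.pow_right m ?_
      simp
    -- Being 1 mod `q`, the exponent is a power of `p`, so its automorphism fixes `y`.
    have hker : ZMod.unitOfCoprime _ hcop ∈ residueSubgroup (q ^ m) p := by
      refine ker_unitsMap_le_residueSubgroup hm hw _ ?_
      ext
      rw [ZMod.unitsMap_val, ZMod.coe_unitOfCoprime,
        ZMod.cast_natCast (dvd_pow_self q (by omega : m ≠ 0))]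
      simp
    obtain ⟨k, hk⟩ := exists_pow_of_mem_residueSubgroup hp hker
    obtain ⟨σ, h1, h2⟩ := exists_algEquiv_pow_fixing hp hz k
    have hpow : ζ ^ p ^ k = ζ ^ (1 + q * s) := by
      refine pow_eq_pow_of_natCast_eq hζ.pow_eq_one ?_
      rw [ZMod.coe_unitOfCoprime] at hk
      rw [hk, Nat.cast_pow]
    calc y = σ y := (h2 y hy).symm
      _ = _ := by
        nth_rewrite 1 [hPy]
        rw [map_sum]
        refine Finset.sum_congr rfl fun t _ => ?_
        rw [map_mul, map_pow, h1 ζ hζ.pow_eq_one, hpow, map_intCast, pow_right_comm]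
  have hn0 : ((q ^ (m - 1) : ℕ) : cyclotomicSubfield (q ^ m)) ≠ 0 := by
    exact_mod_cast pow_ne_zero _ hq.ne_zero
  have havg : y = ∑ t ∈ P.support, (P.coeff t : cyclotomicSubfield (q ^ m)) *
      if (ζ ^ t) ^ q = 1 then ζ ^ t else 0 := by
    refine mul_left_cancel₀ hn0 ?_
    calc ((q ^ (m - 1) : ℕ) : cyclotomicSubfield (q ^ m)) * y
        = ∑ s ∈ Finset.range (q ^ (m - 1)), y := by simp
      _ = ∑ s ∈ Finset.range (q ^ (m - 1)), ∑ t ∈ P.support,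
            (P.coeff t : cyclotomicSubfield (q ^ m)) * (ζ ^ t) ^ (1 + q * s) :=
          Finset.sum_congr rfl fun s _ => hσ s
      _ = _ := by
          rw [Finset.sum_comm, Finset.mul_sum]
          refine Finset.sum_congr rfl fun t _ => ?_
          have hpow : (ζ ^ t) ^ (q * q ^ (m - 1)) = 1 := by
            rw [hNpos, pow_right_comm, hζ.pow_eq_one, one_pow]
          rw [← Finset.mul_sum, sum_pow_one_add_mul hpow, mul_left_comm]
          congr
  rw [← hy, havg]
  push_cast
  refine Submodule.sum_mem _ fun t _ => ?_
  rw [← zsmul_eq_mul]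
  refine Submodule.smul_mem _ _ ?_
  split_ifs with h
  · exact mem_span_unit_pow_of_pow_eq_one hξ (by exact_mod_cast congrArg Subtype.val h)
  · simp

/-- The automorphism attached to `p` fixes `z` and permutes the nontrivial `q`-th roots of unity, so
uniqueness of coefficients forces the invariance. -/
lemma exists_invariant_unit_coeff {q m p : ℕ} [Fact q.Prime] (hm : 1 ≤ m)
    (hp : p.Coprime (q ^ m)) (hw : ((residueSubgroup (q ^ m) p).index).Coprime q)
    {ξ : ℂ} (hξ : IsPrimitiveRoot ξ q) {z : ℂ} (hz : z ∈ decompositionField (q ^ m) p)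
    (hint : IsIntegral ℤ z) :
    ∃ C : (ZMod q)ˣ → ℤ, (∀ h ∈ residueSubgroup q p, ∀ a, C (h * a) = C a) ∧
      z = ∑ a : (ZMod q)ˣ, (C a : ℂ) * ξ ^ (a : ZMod q).val := by
  have hq : q.Prime := Fact.out
  have hmem := mem_span_of_isIntegral_of_mem_decompositionField hm hp hw hξ hz hint
  obtain ⟨C, hC⟩ := Submodule.mem_span_range_iff_exists_fun ℤ |>.mp hmem
  simp only [zsmul_eq_mul] at hC
  refine ⟨C, ?_, hC.symm⟩
  have hξN : ξ ^ q ^ m = 1 := by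
    rw [← Nat.sub_add_cancel hm, pow_succ', pow_mul, hξ.pow_eq_one, one_pow]
  have hinv : ∀ u : (ZMod q)ˣ, (u : ZMod q) = p → ∀ a, C (u * a) = C a := by
    intro u hu
    obtain ⟨σ, h1, h2⟩ := exists_algEquiv_pow_fixing hp hz 1
    rw [pow_one] at h1
    set x : cyclotomicSubfield (q ^ m) := ⟨ξ, mem_cyclotomicSubfield hξN⟩ with hx
    have hx1 : x ^ q ^ m = 1 := Subtype.ext (by simpa [hx] using hξN)
    have hσ := h2 (∑ a : (ZMod q)ˣ, (C a : cyclotomicSubfield (q ^ m)) * x ^ (a : ZMod q).val)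
      (by rw [← hC]; simp [hx])
    have hσ' := congrArg (Subtype.val) hσ
    rw [map_sum] at hσ'
    simp only [map_mul, map_intCast, map_pow, h1 x hx1] at hσ'
    simp only [AddSubmonoidClass.coe_finsetSum, MulMemClass.coe_mul, SubringClass.coe_intCast,
      SubmonoidClass.coe_pow, hx] at hσ'
    have hpow : ∀ a : (ZMod q)ˣ,
        (ξ ^ p) ^ (a : ZMod q).val = ξ ^ ((u * a : (ZMod q)ˣ) : ZMod q).val := by
      intro a
      rw [← pow_mul]
      refine pow_eq_pow_of_natCast_eq hξ.pow_eq_one ?_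
      simp [hu]
    simp only [hpow] at hσ'
    rw [← Equiv.sum_comp (Equiv.mulLeft u) (fun a : (ZMod q)ˣ => (C a : ℂ) * ξ ^ (a : ZMod q).val)]
      at hσ'
    rw [← sub_eq_zero, ← Finset.sum_sub_distrib] at hσ'
    simp only [Equiv.coe_mulLeft, ← sub_mul, ← Int.cast_sub] at hσ'
    rw [← Equiv.sum_comp (Equiv.mulLeft u⁻¹)] at hσ'
    simp only [Equiv.coe_mulLeft, mul_inv_cancel_left] at hσ'
    have h0 := unit_coeff_eq_zero_of_sum_eq_zero hξ (fun a => C (u⁻¹ * a) - C a) hσ'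
    intro a
    have := congrFun h0 (u * a)
    simp only [inv_mul_cancel_left, Pi.zero_apply] at this
    omega
  intro h hh
  induction hh using Subgroup.closure_induction with
  | mem u hu => exact hinv u hu
  | one => simp
  | mul x y _ _ hx hy => intro a; rw [mul_assoc, hx, hy]
  | inv x _ hx => intro a; rw [← hx, mul_inv_cancel_left]

/-! ### Coset representatives and Gauss periods -/

/-- A generator of `G` has order `w` in `G ⧸ H`, so its first `w` powers represent each coset once.
-/
lemma exists_coset_index {G : Type*} [CommGroup G] [Finite G] (g : G)
    (hg : orderOf g = Nat.card G) (H : Subgroup G) {w : ℕ} (hw : w = H.index) :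
    ∃ cls : G → Fin w, ∀ a (j : Fin w), (∃ h ∈ H, a = g ^ (j : ℕ) * h) ↔ cls a = j := by
  have hord : orderOf (g : G ⧸ H) = w := by
    rw [hw, ← Nat.card_zpowers, Subgroup.index_eq_card]
    have htop : Subgroup.zpowers g = ⊤ :=
      Subgroup.eq_top_of_card_eq _ (by rw [Nat.card_zpowers, hg])
    have : Subgroup.zpowers (g : G ⧸ H) = ⊤ := by
      have := MonoidHom.map_zpowers (QuotientGroup.mk' H) g
      rw [htop, ← MonoidHom.range_eq_map, MonoidHom.range_eq_top.mpr
        (QuotientGroup.mk'_surjective H)] at this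
      exact this.symm
    rw [this, Subgroup.card_top]
  have hbij : Function.Bijective fun j : Fin w => (g : G ⧸ H) ^ (j : ℕ) := by
    rw [Nat.bijective_iff_injective_and_card]
    refine ⟨fun i j hij => ?_, by rw [Nat.card_fin, hw, Subgroup.index_eq_card]⟩
    have := pow_inj_mod.mp hij
    rw [hord, Nat.mod_eq_of_lt i.2, Nat.mod_eq_of_lt j.2] at this
    exact Fin.ext this
  refine ⟨fun a => (Equiv.ofBijective _ hbij).symm a, fun a j => ?_⟩
  rw [Equiv.symm_apply_eq, Equiv.ofBijective_apply, ← QuotientGroup.mk_pow, eq_comm (a := (a : G ⧸ H)),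
    QuotientGroup.eq]
  constructor
  · rintro ⟨h, hh, rfl⟩
    simpa using hh
  · intro h
    exact ⟨_, h, by simp⟩

lemma sum_mul_gaussPeriod {q p w : ℕ} [NeZero q] {g : (ZMod q)ˣ} (ξ : ℂ)
    {cls : (ZMod q)ˣ → Fin w}
    (hcls : ∀ a (j : Fin w), (∃ h ∈ residueSubgroup q p, a = g ^ (j : ℕ) * h) ↔ cls a = j)
    (c : Fin w → ℤ) :
    ∑ i, (c i : ℂ) * gaussPeriod q p g ξ i =
      ∑ a : (ZMod q)ˣ, (c (cls a) : ℂ) * ξ ^ (a : ZMod q).val := by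
  rw [← Finset.sum_fiberwise Finset.univ cls]
  refine Finset.sum_congr rfl fun j _ => ?_
  rw [gaussPeriod, Finset.mul_sum]
  simp only [hcls]
  refine Finset.sum_congr rfl fun a ha => ?_
  rw [(Finset.mem_filter.mp ha).2]

lemma card_coset_fiber {G : Type*} [CommGroup G] [Fintype G] {g : G} {H : Subgroup G} {w : ℕ}
    {cls : G → Fin w} (hcls : ∀ a (j : Fin w), (∃ h ∈ H, a = g ^ (j : ℕ) * h) ↔ cls a = j) (j : Fin w) :
    (Finset.univ.filter fun a => cls a = j).card = Nat.card H := by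
  have : (Finset.univ.filter fun a => cls a = j) =
      (H : Set G).toFinset.image fun h => g ^ (j : ℕ) * h := by
    ext a
    rw [Finset.mem_filter, ← hcls]
    simp only [Finset.mem_univ, true_and, Finset.mem_image, Set.mem_toFinset, SetLike.mem_coe,
      eq_comm]
  rw [this, Finset.card_image_of_injective _ (mul_right_injective _), Set.toFinset_card,
    Nat.card_eq_fintype_card]
  rfl

/-! ### Gauss sums of characters trivial on the prime field -/

lemma canonicalAddChar_apply {p : ℕ} [NeZero p] {F : Type*} [Field F] [Algebra (ZMod p) F]
    {ξp : ℂ} (hξp : ξp ^ p = 1) (x : F) :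
    canonicalAddChar F hξp x = AddChar.zmodChar p hξp (Algebra.trace (ZMod p) F x) := rfl

/-- Lifts character values to where automorphisms act; the alternative `u = 0` covers `x = 0`. -/
lemma exists_cyclotomic_lift {F : Type*} [Field F] {N : ℕ} (χ : MulChar F ℂ) (hχN : ∀ x, x ≠ 0 → χ x ^ N = 1) (x : F) :
    ∃ u : cyclotomicSubfield N, (u : ℂ) = χ x ∧ (u = 0 ∨ u ^ N = 1) := by
  by_cases hx : x = 0
  · exact ⟨0, by rw [hx, MulChar.map_zero, ZeroMemClass.coe_zero], Or.inl rfl⟩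
  · exact ⟨⟨χ x, mem_cyclotomicSubfield (hχN x hx)⟩, rfl, Or.inr (Subtype.ext (hχN x hx))⟩

section GaussSum

variable {p : ℕ} [Fact p.Prime] {F : Type*} [Field F] [Fintype F] [Algebra (ZMod p) F]
  {ξp : ℂ}

lemma canonicalAddChar_isPrimitive (hξp : IsPrimitiveRoot ξp p) :
    (canonicalAddChar F hξp.pow_eq_one : AddChar F ℂ).IsPrimitive := by
  refine AddChar.IsPrimitive.of_ne_one fun h => ?_
  have : Algebra.trace (ZMod p) F = 0 := by
    ext x
    have hx := DFunLike.congr_fun h x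
    rw [canonicalAddChar_apply, AddChar.one_apply,
      (AddChar.zmodChar_primitive_of_primitive_root p hξp).zmod_char_eq_one_iff] at hx
    exact hx
  exact Algebra.trace_ne_zero (ZMod p) F this

/-- Scaling `x` by a unit of the prime field preserves the Gauss sum; summing over these units
replaces `ψ` by an indicator of trace zero minus a constant, and the constant dies against `χ`. The
result is free of `ξp`, so automorphisms of `ℚ(ξ_N)` can act on it. -/
lemma sub_one_mul_gaussSum (hξp : IsPrimitiveRoot ξp p) {χ : MulChar F ℂ} (hχ : χ ≠ 1)
    (hχp : ∀ c : (ZMod p)ˣ, χ (algebraMap (ZMod p) F c) = 1) :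
    ((p : ℂ) - 1) * gaussSum χ (canonicalAddChar F hξp.pow_eq_one) =
      p * ∑ x : F with Algebra.trace (ZMod p) F x = 0, χ x := by
  have hp : p.Prime := Fact.out
  set ψ : AddChar F ℂ := canonicalAddChar F hξp.pow_eq_one with hψ
  have hshift : ∀ c : (ZMod p)ˣ,
      gaussSum χ ψ = ∑ x, χ x * AddChar.zmodChar p hξp.pow_eq_one
        ((c : ZMod p) * Algebra.trace (ZMod p) F x) := by
    intro c
    have := gaussSum_mulShift χ ψ (Units.map (algebraMap (ZMod p) F).toMonoidHom c)
    simp only [RingHom.toMonoidHom_eq_coe, Units.coe_map, MonoidHom.coe_coe, hχp, one_mul] at this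
    rw [← this, gaussSum]
    refine Finset.sum_congr rfl fun x _ => ?_
    rw [AddChar.mulShift_apply, hψ, canonicalAddChar_apply, ← Algebra.smul_def, map_smul,
      smul_eq_mul]
  have hinner : ∀ y : ZMod p, ∑ c : (ZMod p)ˣ,
      AddChar.zmodChar p hξp.pow_eq_one ((c : ZMod p) * y) = (if y = 0 then (p : ℂ) else 0) - 1 := by
    intro y
    have h1 := AddChar.sum_mulShift y (AddChar.zmodChar_primitive_of_primitive_root p hξp)
    rw [ZMod.card, Fintype.sum_eq_add_sum_compl 0] at h1
    have h2 : ∑ c : (ZMod p)ˣ, AddChar.zmodChar p hξp.pow_eq_one ((c : ZMod p) * y) =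
        ∑ c ∈ ({0}ᶜ : Finset (ZMod p)), AddChar.zmodChar p hξp.pow_eq_one (c * y) := by
      refine Finset.sum_bij (fun c _ => (c : ZMod p)) ?_ ?_ ?_ ?_
      · intro c _
        simp
      · intro c _ d _ h
        exact Units.ext h
      · intro c hc
        exact ⟨Units.mk0 c (by simpa using hc), Finset.mem_univ _, rfl⟩
      · intro c _
        rfl
    rw [h2, eq_sub_iff_add_eq', ← Nat.cast_zero (R := ℂ), ← Nat.cast_ite, ← h1]
    simp
  have hcard : ((Fintype.card (ZMod p)ˣ : ℕ) : ℂ) = (p : ℂ) - 1 := by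
    rw [ZMod.card_units_eq_totient, Nat.totient_prime hp, Nat.cast_sub hp.one_le, Nat.cast_one]
  calc ((p : ℂ) - 1) * gaussSum χ ψ = ∑ c : (ZMod p)ˣ, gaussSum χ ψ := by
        rw [Finset.sum_const, Finset.card_univ, nsmul_eq_mul, hcard]
    _ = ∑ x, χ x * ((if Algebra.trace (ZMod p) F x = 0 then (p : ℂ) else 0) - 1) := by
        rw [Finset.sum_congr rfl fun c _ => hshift c, Finset.sum_comm]
        refine Finset.sum_congr rfl fun x _ => ?_
        rw [← Finset.mul_sum, hinner]
    _ = _ := by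
        simp_rw [mul_sub, mul_one, Finset.sum_sub_distrib, MulChar.sum_eq_zero_of_ne_one hχ,
          mul_ite, mul_zero, ← Finset.sum_filter, ← Finset.sum_mul]
        ring

/-- Frobenius permutes the elements of trace zero. -/
lemma gaussSum_pow_char (hξp : IsPrimitiveRoot ξp p) {χ : MulChar F ℂ} (hχ : χ ≠ 1)
    (hχp : ∀ c : (ZMod p)ˣ, χ (algebraMap (ZMod p) F c) = 1) (hχ' : χ ^ p ≠ 1) :
    gaussSum (χ ^ p) (canonicalAddChar F hξp.pow_eq_one) =
      gaussSum χ (canonicalAddChar F hξp.pow_eq_one) := by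
  have hp : p.Prime := Fact.out
  have hp1 : (p : ℂ) - 1 ≠ 0 := sub_ne_zero.mpr (by exact_mod_cast hp.one_lt.ne')
  refine mul_left_cancel₀ hp1 ?_
  rw [sub_one_mul_gaussSum hξp hχ hχp, sub_one_mul_gaussSum hξp hχ'
    (fun c => by rw [MulChar.pow_apply' _ hp.ne_zero, hχp, one_pow])]
  congr 1
  have hfrob : ∀ x : F, FiniteField.frobeniusAlgEquivOfAlgebraic (ZMod p) F x = x ^ p := by
    intro x
    simp
  refine Finset.sum_equiv (FiniteField.frobeniusAlgEquivOfAlgebraic (ZMod p) F).toEquiv ?_ ?_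
  · intro x
    simp only [Finset.mem_filter, Finset.mem_univ, true_and]
    change _ ↔ Algebra.trace (ZMod p) F (FiniteField.frobeniusAlgEquivOfAlgebraic (ZMod p) F x) = 0
    rw [Algebra.trace_eq_of_algEquiv]
  · intro x _
    change _ = χ (FiniteField.frobeniusAlgEquivOfAlgebraic (ZMod p) F x)
    rw [hfrob, map_pow, MulChar.pow_apply' _ hp.ne_zero]

lemma isIntegral_gaussSum (hξp : ξp ^ p = 1) (χ : MulChar F ℂ) :
    IsIntegral ℤ (gaussSum χ (canonicalAddChar F hξp)) := by
  have hp : p.Prime := Fact.out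
  refine IsIntegral.sum _ fun x _ => IsIntegral.mul ?_ ?_
  · by_cases hx : x = 0
    · rw [hx, MulChar.map_zero]
      exact isIntegral_zero
    · refine IsIntegral.of_pow (n := Fintype.card F - 1)
        (by have := Fintype.one_lt_card (α := F); omega) ?_
      rw [← map_pow, FiniteField.pow_card_sub_one_eq_one x hx, map_one]
      exact isIntegral_one
  · refine IsIntegral.of_pow (n := p) hp.pos ?_
    rw [canonicalAddChar_apply, AddChar.zmodChar_apply, pow_right_comm, hξp, one_pow]
    exact isIntegral_one

/-- The quotient times its conjugate is `p^f / p^(2k)`, a rational algebraic integer, hence a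
positive integer. This bounds the exponents, so a largest one exists. -/
lemma exponent_le_of_isIntegral_gaussSum_div (hξp : IsPrimitiveRoot ξp p) {χ : MulChar F ℂ}
    (hχ : χ ≠ 1) {f k : ℕ} (hF : Fintype.card F = p ^ f)
    (hk : IsIntegral ℤ (gaussSum χ (canonicalAddChar F hξp.pow_eq_one) / (p : ℂ) ^ k)) :
    k ≤ f := by
  have hp : p.Prime := Fact.out
  have hp0 : (p : ℂ) ≠ 0 := by exact_mod_cast hp.ne_zero
  set z := gaussSum χ (canonicalAddChar F hξp.pow_eq_one) / (p : ℂ) ^ k with hz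
  have hconj : IsIntegral ℤ (star z) := hk.map (starRingEnd ℂ).toIntAlgHom
  have hprod : z * star z = algebraMap ℚ ℂ ((p : ℚ) ^ f / (p : ℚ) ^ (2 * k)) := by
    have h1 := gaussSum_mul_gaussSum_eq_card hχ (canonicalAddChar_isPrimitive (F := F) hξp)
    rw [← star_gaussSum_eq, hF] at h1
    rw [hz, star_div₀, div_mul_div_comm, h1]
    simp only [star_pow, star_natCast, eq_ratCast, Rat.cast_div, Rat.cast_pow, Rat.cast_natCast,
      Nat.cast_pow]
    rw [two_mul, pow_add]
  have hint : IsIntegral ℤ ((p : ℚ) ^ f / (p : ℚ) ^ (2 * k)) := by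
    have h2 := hk.mul hconj
    rw [hprod] at h2
    exact (isIntegral_algebraMap_iff (algebraMap ℚ ℂ).injective).mp h2
  obtain ⟨n, hn⟩ := IsIntegrallyClosed.isIntegral_iff.mp hint
  have hpQ : (0 : ℚ) < p := by exact_mod_cast hp.pos
  rw [eq_intCast, eq_div_iff (by positivity)] at hn
  have hpos : 0 < n := by
    by_contra hneg
    have : (n : ℚ) ≤ 0 := by exact_mod_cast not_lt.mp hneg
    have h3 : (n : ℚ) * (p : ℚ) ^ (2 * k) ≤ 0 := mul_nonpos_of_nonpos_of_nonneg this (by positivity)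
    rw [hn] at h3
    exact absurd h3 (not_le.mpr (by positivity))
  have hle : (p : ℚ) ^ (2 * k) ≤ (p : ℚ) ^ f := by
    rw [← hn]
    exact le_mul_of_one_le_left (by positivity) (by exact_mod_cast hpos)
  have := (pow_le_pow_iff_right₀ (by exact_mod_cast hp.one_lt : (1 : ℚ) < p)).mp hle
  omega

variable {N : ℕ}

lemma gaussSum_mem_cyclotomicSubfield (hξp : IsPrimitiveRoot ξp p) {χ : MulChar F ℂ} (hχ : χ ≠ 1)
    (hχN : ∀ x, x ≠ 0 → χ x ^ N = 1)
    (hχp : ∀ c : (ZMod p)ˣ, χ (algebraMap (ZMod p) F c) = 1) :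
    gaussSum χ (canonicalAddChar F hξp.pow_eq_one) ∈ cyclotomicSubfield N := by
  have hp : p.Prime := Fact.out
  have hp1 : (p : ℂ) - 1 ≠ 0 := sub_ne_zero.mpr (by exact_mod_cast hp.one_lt.ne')
  rw [eq_div_of_mul_eq hp1 ((mul_comm _ _).trans (sub_one_mul_gaussSum hξp hχ hχp))]
  refine div_mem (mul_mem (natCast_mem _ _) (sum_mem fun x _ => ?_))
    (sub_mem (natCast_mem _ _) (one_mem _))
  obtain ⟨u, hu, -⟩ := exists_cyclotomic_lift χ hχN x
  rw [← hu]
  exact u.2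

lemma algEquiv_gaussSum (hξp : IsPrimitiveRoot ξp p) {χ : MulChar F ℂ} (hχ : χ ≠ 1)
    (hχN : ∀ x, x ≠ 0 → χ x ^ N = 1)
    (hχp : ∀ c : (ZMod p)ˣ, χ (algebraMap (ZMod p) F c) = 1) {k : ℕ} (hχk : χ ^ k ≠ 1)
    (σ : cyclotomicSubfield N ≃ₐ[ℚ] cyclotomicSubfield N)
    (hσ : ∀ x : cyclotomicSubfield N, x ^ N = 1 → σ x = x ^ k)
    (y : cyclotomicSubfield N)
    (hy : (y : ℂ) = gaussSum χ (canonicalAddChar F hξp.pow_eq_one)) :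
    (σ y : ℂ) = gaussSum (χ ^ k) (canonicalAddChar F hξp.pow_eq_one) := by
  have hp : p.Prime := Fact.out
  have hk0 : k ≠ 0 := by
    rintro rfl
    exact hχk (pow_zero χ)
  have hp1 : (p : ℂ) - 1 ≠ 0 := sub_ne_zero.mpr (by exact_mod_cast hp.one_lt.ne')
  choose u hu hu' using exists_cyclotomic_lift (N := N) χ hχN
  have hσu : ∀ x, σ (u x) = u x ^ k := by
    intro x
    rcases hu' x with h | h
    · rw [h, map_zero, zero_pow hk0]
    · exact hσ _ h
  have hsum : ((p : cyclotomicSubfield N) - 1) * y =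
      p * ∑ x : F with Algebra.trace (ZMod p) F x = 0, u x := by
    apply Subtype.ext
    push_cast
    rw [hy, sub_one_mul_gaussSum hξp hχ hχp]
    simp only [hu]
  have hsum' := congrArg (fun v => (σ v : ℂ)) hsum
  simp only [map_mul, map_sub, map_natCast, map_one, map_sum, hσu] at hsum'
  push_cast at hsum'
  refine mul_left_cancel₀ hp1 ?_
  rw [hsum', sub_one_mul_gaussSum hξp hχk
    (fun c => by rw [MulChar.pow_apply' _ hk0, hχp, one_pow])]
  simp only [hu, MulChar.pow_apply' _ hk0]

lemma gaussSum_mem_decompositionField (hξp : IsPrimitiveRoot ξp p) {χ : MulChar F ℂ} (hχ : χ ≠ 1)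
    (hχN : ∀ x, x ≠ 0 → χ x ^ N = 1)
    (hχp : ∀ c : (ZMod p)ˣ, χ (algebraMap (ZMod p) F c) = 1) (hχ' : χ ^ p ≠ 1) :
    gaussSum χ (canonicalAddChar F hξp.pow_eq_one) ∈ decompositionField N p := by
  refine mem_decompositionField_iff.mpr
    ⟨gaussSum_mem_cyclotomicSubfield hξp hχ hχN hχp, fun σ hσ => Subtype.ext ?_⟩
  rw [algEquiv_gaussSum hξp hχ hχN hχp hχ' σ hσ _ rfl, gaussSum_pow_char hξp hχ hχp hχ']

lemma exists_isLargestExponent (hξp : IsPrimitiveRoot ξp p) {χ : MulChar F ℂ} (hχ : χ ≠ 1)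
    (hχN : ∀ x, x ≠ 0 → χ x ^ N = 1)
    (hχp : ∀ c : (ZMod p)ˣ, χ (algebraMap (ZMod p) F c) = 1) (hχ' : χ ^ p ≠ 1) {f : ℕ}
    (hF : Fintype.card F = p ^ f) :
    ∃ r, IsLargestExponent N p (gaussSum χ (canonicalAddChar F hξp.pow_eq_one)) r := by
  refine ⟨_, Nat.sSup_mem ⟨0, ?_⟩ ⟨f, fun k hk =>
    exponent_le_of_isIntegral_gaussSum_div hξp hχ hF hk.2⟩, fun k hk => le_csSup ⟨f, fun k hk =>
    exponent_le_of_isIntegral_gaussSum_div hξp hχ hF hk.2⟩ hk⟩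
  simp only [Set.mem_ofPred_eq, pow_zero, div_one]
  exact ⟨gaussSum_mem_decompositionField hξp hχ hχN hχp hχ', isIntegral_gaussSum _ _⟩

end GaussSum

/-! ### Roots of unity of prime power order -/

/-- The powers `ξN ^ i`, `i < q^(m-1)`, represent the cosets of the `q`-th roots of unity among the
`q^m`-th ones; the pair is the decomposition of `x⁻¹`. -/
lemma exists_unique_root_relation {q m : ℕ} [Fact q.Prime] (hm : 1 ≤ m) {ξN ξ x : ℂ}
    (hξN : IsPrimitiveRoot ξN (q ^ m)) (hξ : IsPrimitiveRoot ξ q) (hx : x ^ q ^ m = 1) :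
    ∃ i₀ < q ^ (m - 1), ∃ u : ZMod q, ∀ i < q ^ (m - 1), ∀ a : ZMod q,
      x * ξN ^ i * ξ ^ a.val = 1 ↔ i = i₀ ∧ a = u := by
  have hq : q.Prime := Fact.out
  have hn : 0 < q ^ (m - 1) := pow_pos hq.pos _
  have hN : q ^ m = q * q ^ (m - 1) := by rw [← pow_succ', Nat.sub_add_cancel hm]
  have hξN' : ∀ k, ξN ^ k = 1 ↔ q * q ^ (m - 1) ∣ k := by
    intro k
    rw [hξN.pow_eq_one_iff_dvd, hN]
  obtain ⟨b, -, rfl⟩ := hξN.eq_pow_of_pow_eq_one hx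
  set n := q ^ (m - 1) with hndef
  have hdvd : ∀ i, (ξN ^ b * ξN ^ i) ^ q = 1 ↔ n ∣ b + i := by
    intro i
    rw [← pow_add, ← pow_mul, hξN', mul_comm q, Nat.mul_dvd_mul_iff_right hq.pos]
  obtain ⟨i₀, hi₀, hi₀'⟩ : ∃ i₀ < n, n ∣ b + i₀ := by
    -- The residue of `-b` mod `n`; the outer reduction handles `n ∣ b`.
    refine ⟨(n - b % n) % n, Nat.mod_lt _ hn, ?_⟩
    rw [Nat.dvd_iff_mod_eq_zero, Nat.add_mod_mod, ← Nat.mod_add_mod,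
      Nat.add_sub_cancel' (Nat.mod_lt _ hn).le, Nat.mod_self]
  obtain ⟨k, -, hk⟩ := hξ.eq_pow_of_pow_eq_one ((hdvd i₀).mpr hi₀')
  refine ⟨i₀, hi₀, -(k : ZMod q), fun i hi a => ?_⟩
  have hlast : ξN ^ b * ξN ^ i₀ * ξ ^ a.val = 1 ↔ a = -(k : ZMod q) := by
    rw [← hk, ← pow_add, hξ.pow_eq_one_iff_dvd, ← ZMod.natCast_eq_zero_iff]
    simp [add_eq_zero_iff_eq_neg']
  constructor
  · intro h
    have h1 : (ξN ^ b * ξN ^ i) ^ q = 1 := by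
      have h2 := congrArg (· ^ q) h
      simpa only [mul_pow _ (ξ ^ a.val), pow_right_comm ξ a.val q, hξ.pow_eq_one, one_pow, mul_one]
        using h2
    rw [hdvd] at h1
    have h3 : i = i₀ := by
      have h4 : b + i ≡ b + i₀ [MOD n] :=
        ((Nat.modEq_zero_iff_dvd).mpr h1).trans ((Nat.modEq_zero_iff_dvd).mpr hi₀').symm
      exact Nat.ModEq.eq_of_lt_of_lt (Nat.ModEq.add_left_cancel' b h4) hi hi₀
    subst h3
    exact ⟨rfl, hlast.mp h⟩
  · rintro ⟨rfl, h⟩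
    exact hlast.mpr h

lemma sum_range_pow_eq_ite {N : ℕ} {y : ℂ} (hy : y ^ N = 1) :
    ∑ t ∈ Finset.range N, y ^ t = if y = 1 then (N : ℂ) else 0 := by
  split_ifs with h
  · simp [h]
  · have := geom_sum_mul y N
    rw [hy, sub_self] at this
    exact (mul_eq_zero.mp this).resolve_right (sub_ne_zero.mpr h)

/-- The Fourier sum of a function on `ℤ/q^m` whose values at `t` prime to `q` are given by the
conjugates `∑ C(a) ξ^(at)`. -/
lemma sum_sum_pow_mul_eq {q m : ℕ} [Fact q.Prime] (hm : 1 ≤ m) {ξN ξ x : ℂ}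
    (hξN : IsPrimitiveRoot ξN (q ^ m)) (hξ : IsPrimitiveRoot ξ q) (hx : x ^ q ^ m = 1)
    (C : (ZMod q)ˣ → ℂ) (G : ℕ → ℂ)
    (hG : ∀ t, t.Coprime q → G t = ∑ a : (ZMod q)ˣ, C a * (ξ ^ (a : ZMod q).val) ^ t) :
    ∑ t ∈ Finset.range (q ^ m), ∑ i ∈ Finset.range (q ^ (m - 1)), (x * ξN ^ i) ^ t * G t =
      (q : ℂ) ^ (m - 1) * (G 0 - ∑ a : (ZMod q)ˣ, C a) +
      (q : ℂ) ^ m * ∑ a : (ZMod q)ˣ, C a * ∑ i ∈ Finset.range (q ^ (m - 1)),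
        if x * ξN ^ i * ξ ^ (a : ZMod q).val = 1 then 1 else 0 := by
  have hq : q.Prime := Fact.out
  have hN : q * q ^ (m - 1) = q ^ m := by rw [← pow_succ', Nat.sub_add_cancel hm]
  -- `E` extends the formula for `G` to every `t`. The error `G - E` matters only at `t = 0`: for
  -- other multiples `t` of `q` the geometric sum over `i` vanishes.
  set E : ℕ → ℂ := fun t => ∑ a : (ZMod q)ˣ, C a * (ξ ^ (a : ZMod q).val) ^ t with hE
  have hξ1 : ξ ^ q ^ m = 1 := by rw [← hN, pow_mul, hξ.pow_eq_one, one_pow]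
  have hzero : ∀ t ∈ Finset.range (q ^ m), t ≠ 0 →
      ∑ i ∈ Finset.range (q ^ (m - 1)), (x * ξN ^ i) ^ t * (G t - E t) = 0 := by
    intro t ht ht0
    by_cases hcop : t.Coprime q
    · simp [hG t hcop, hE]
    · obtain ⟨s, rfl⟩ : q ∣ t := by
        by_contra h
        exact hcop ((Nat.Prime.coprime_iff_not_dvd hq).mpr h).symm
      have h1 : ξN ^ (q * s) ≠ 1 := by
        rw [Ne, hξN.pow_eq_one_iff_dvd]
        exact fun h => Nat.not_dvd_of_pos_of_lt (Nat.pos_of_ne_zero ht0) (Finset.mem_range.mp ht) h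
      have h2 : (ξN ^ (q * s)) ^ q ^ (m - 1) = 1 := by
        rw [← pow_mul, mul_right_comm, hN, pow_mul, hξN.pow_eq_one, one_pow]
      simp_rw [mul_pow x, pow_right_comm ξN _ (q * s)]
      rw [← Finset.sum_mul, ← Finset.mul_sum, sum_range_pow_eq_ite h2, if_neg h1, mul_zero, zero_mul]
  have hsplit : ∑ t ∈ Finset.range (q ^ m), ∑ i ∈ Finset.range (q ^ (m - 1)),
      (x * ξN ^ i) ^ t * (G t - E t) = (q : ℂ) ^ (m - 1) * (G 0 - ∑ a : (ZMod q)ˣ, C a) := by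
    rw [Finset.sum_eq_single_of_mem 0 (Finset.mem_range.mpr (pow_pos hq.pos m)) hzero]
    simp [hE, mul_sub]
  have hmain : ∑ t ∈ Finset.range (q ^ m), ∑ i ∈ Finset.range (q ^ (m - 1)),
      (x * ξN ^ i) ^ t * E t = (q : ℂ) ^ m * ∑ a : (ZMod q)ˣ, C a *
        ∑ i ∈ Finset.range (q ^ (m - 1)),
        if x * ξN ^ i * ξ ^ (a : ZMod q).val = 1 then 1 else 0 := by
    have hinner : ∀ a : (ZMod q)ˣ, ∀ i, ∑ t ∈ Finset.range (q ^ m),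
        (x * ξN ^ i * ξ ^ (a : ZMod q).val) ^ t =
          (q : ℂ) ^ m * if x * ξN ^ i * ξ ^ (a : ZMod q).val = 1 then 1 else 0 := by
      intro a i
      rw [sum_range_pow_eq_ite]
      · simp
      · rw [mul_pow, mul_pow, hx, pow_right_comm, hξN.pow_eq_one, pow_right_comm, hξ1]
        simp
    calc _ = ∑ a : (ZMod q)ˣ, ∑ i ∈ Finset.range (q ^ (m - 1)), ∑ t ∈ Finset.range (q ^ m),
          C a * (x * ξN ^ i * ξ ^ (a : ZMod q).val) ^ t := by
          simp_rw [hE, Finset.mul_sum]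
          rw [Finset.sum_congr rfl fun t _ => Finset.sum_comm, Finset.sum_comm]
          refine Finset.sum_congr rfl fun a _ => ?_
          rw [Finset.sum_comm]
          refine Finset.sum_congr rfl fun i _ => Finset.sum_congr rfl fun t _ => ?_
          rw [mul_pow _ (ξ ^ (a : ZMod q).val)]
          ring
      _ = _ := by
          simp_rw [← Finset.mul_sum, hinner, Finset.mul_sum]
          refine Finset.sum_congr rfl fun a _ => Finset.sum_congr rfl fun i _ => ?_
          ring
  rw [← hsplit, ← hmain, ← Finset.sum_add_distrib]
  refine Finset.sum_congr rfl fun t _ => ?_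
  rw [← Finset.sum_add_distrib]
  refine Finset.sum_congr rfl fun i _ => ?_
  ring

/-! ### The connection set -/

section ConnectionSet

variable {F : Type*} [Field F] [Fintype F] {γ : F} {q m : ℕ} {ξN : ℂ} {θ : MulChar F ℂ}

lemma exists_pow_eq_of_ne_zero (hγ : IsPrimitiveRoot γ (Fintype.card F - 1)) {x : F}
    (hx : x ≠ 0) : ∃ k < Fintype.card F - 1, γ ^ k = x := by
  have : NeZero (Fintype.card F - 1) := ⟨by have := Fintype.one_lt_card (α := F); omega⟩
  exact hγ.eq_pow_of_pow_eq_one (FiniteField.pow_card_sub_one_eq_one x hx)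

lemma mulChar_pow_eq_one {N : ℕ} (hγ : IsPrimitiveRoot γ (Fintype.card F - 1))
    (hθ : θ γ ^ N = 1) {x : F} (hx : x ≠ 0) : θ x ^ N = 1 := by
  obtain ⟨k, -, rfl⟩ := exists_pow_eq_of_ne_zero hγ hx
  rw [map_pow, pow_right_comm, hθ, one_pow]

/-- `θ (γ ^ k)` records exactly `k` mod `q^m`, that is, the cyclotomic class. -/
lemma mem_connectionSet_iff [NeZero q] (hγ : IsPrimitiveRoot γ (Fintype.card F - 1))
    (hdvd : q ^ m ∣ Fintype.card F - 1) (hξN : IsPrimitiveRoot ξN (q ^ m)) (hθ : θ γ = ξN) (x : F) :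
    x ∈ connectionSet γ q m ↔ x ≠ 0 ∧ ∃ i < q ^ (m - 1), θ x = ξN ^ i := by
  have hN : 0 < q ^ m := pow_pos (NeZero.pos q) m
  have hle : q ^ (m - 1) ≤ q ^ m := Nat.pow_le_pow_right (NeZero.pos q) (by omega)
  have hγ0 : γ ≠ 0 := by
    have := Fintype.one_lt_card (α := F)
    exact hγ.ne_zero (by omega)
  constructor
  · rintro ⟨i, hi, j, -, rfl⟩
    refine ⟨pow_ne_zero _ hγ0, i, hi, ?_⟩
    rw [map_pow, hθ, pow_add, mul_comm j, pow_mul, hξN.pow_eq_one, one_pow, mul_one]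
  · rintro ⟨hx, i, hi, hi'⟩
    obtain ⟨k, hk, rfl⟩ := exists_pow_eq_of_ne_zero hγ hx
    rw [map_pow, hθ, pow_eq_pow_mod k hξN.pow_eq_one] at hi'
    have hki := hξN.pow_inj (Nat.mod_lt k hN) (hi.trans_le hle) hi'
    refine ⟨i, hi, k / q ^ m, ?_, ?_⟩
    · rw [Nat.card_eq_fintype_card]
      exact Nat.div_lt_div_of_lt_of_dvd hdvd hk
    · rw [← hki, Nat.mod_add_div']

/-- Orthogonality of the powers of `θ`, which detect the cyclotomic class. At `x = 0` all characters
vanish, including the trivial one at `t = 0`. -/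
lemma sum_connectionSet [NeZero q] (hγ : IsPrimitiveRoot γ (Fintype.card F - 1))
    (hdvd : q ^ m ∣ Fintype.card F - 1) (hξN : IsPrimitiveRoot ξN (q ^ m)) (hθ : θ γ = ξN)
    (φ : F → ℂ) :
    (q : ℂ) ^ m * ∑ x ∈ (connectionSet γ q m).toFinset, φ x =
      ∑ t ∈ Finset.range (q ^ m), ∑ i ∈ Finset.range (q ^ (m - 1)),
        (ξN ^ i) ^ t * ∑ x, (θ⁻¹ ^ t) x * φ x := by
  have hle : q ^ (m - 1) ≤ q ^ m := Nat.pow_le_pow_right (NeZero.pos q) (by omega)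
  have hind : ∀ x : F, ∑ t ∈ Finset.range (q ^ m), ∑ i ∈ Finset.range (q ^ (m - 1)),
      (ξN ^ i) ^ t * (θ⁻¹ ^ t) x = if x ∈ connectionSet γ q m then (q : ℂ) ^ m else 0 := by
    intro x
    by_cases hx : x = 0
    · rw [if_neg (by rw [mem_connectionSet_iff hγ hdvd hξN hθ]; exact fun h => h.1 hx)]
      refine Finset.sum_eq_zero fun t _ => Finset.sum_eq_zero fun i _ => ?_
      rw [hx, MulChar.map_zero, mul_zero]
    · have hθx : θ x ≠ 0 := ((isUnit_iff_ne_zero.mpr hx).map θ).ne_zero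
      have hθN := mulChar_pow_eq_one hγ (N := q ^ m) (by rw [hθ]; exact hξN.pow_eq_one) hx
      have hpow : ∀ t, (θ⁻¹ ^ t) x = (θ x)⁻¹ ^ t := by
        intro t
        rcases Nat.eq_zero_or_pos t with rfl | ht
        · rw [pow_zero, pow_zero, MulChar.one_apply (isUnit_iff_ne_zero.mpr hx)]
        · rw [MulChar.pow_apply' _ ht.ne', MulChar.inv_apply_eq_inv, Ring.inverse_eq_inv']
      have hone : ∀ i, ∑ t ∈ Finset.range (q ^ m), (ξN ^ i * (θ x)⁻¹) ^ t =
          if θ x = ξN ^ i then (q : ℂ) ^ m else 0 := by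
        intro i
        rw [sum_range_pow_eq_ite (by
          rw [mul_pow, pow_right_comm, hξN.pow_eq_one, one_pow, inv_pow, hθN, inv_one, one_mul])]
        simp only [mul_inv_eq_one₀ hθx, eq_comm (a := ξN ^ i), Nat.cast_pow]
      simp_rw [hpow, ← mul_pow]
      rw [Finset.sum_comm, Finset.sum_congr rfl fun i _ => hone i]
      split_ifs with hmem
      · obtain ⟨-, i, hi, hi'⟩ := (mem_connectionSet_iff hγ hdvd hξN hθ x).mp hmem
        rw [Finset.sum_eq_single_of_mem i (Finset.mem_range.mpr hi), if_pos hi']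
        intro j hj hji
        rw [if_neg]
        intro h
        exact hji (hξN.pow_inj ((Finset.mem_range.mp hj).trans_le hle) (hi.trans_le hle)
          (h.symm.trans hi'))
      · refine Finset.sum_eq_zero fun i hi => if_neg fun h => hmem ?_
        exact (mem_connectionSet_iff hγ hdvd hξN hθ x).mpr ⟨hx, i, Finset.mem_range.mp hi, h⟩
  calc (q : ℂ) ^ m * ∑ x ∈ (connectionSet γ q m).toFinset, φ x
      = ∑ x, (if x ∈ connectionSet γ q m then (q : ℂ) ^ m else 0) * φ x := by
        simp only [ite_mul, zero_mul, ← Finset.sum_filter, Finset.mul_sum]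
        refine Finset.sum_congr ?_ fun _ _ => rfl
        ext x
        simp
    _ = _ := by
        simp_rw [← hind, Finset.sum_mul]
        rw [Finset.sum_comm]
        refine Finset.sum_congr rfl fun t _ => ?_
        rw [Finset.sum_comm]
        refine Finset.sum_congr rfl fun i _ => ?_
        rw [Finset.mul_sum]
        simp_rw [mul_assoc]

/-- `θ (-1)` is killed by 2 and by the odd number `q^m`, so it is 1. -/
lemma neg_mem_connectionSet_iff [NeZero q] (hγ : IsPrimitiveRoot γ (Fintype.card F - 1))
    (hdvd : q ^ m ∣ Fintype.card F - 1) (hξN : IsPrimitiveRoot ξN (q ^ m)) (hθ : θ γ = ξN)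
    (hodd : Odd (q ^ m)) (x : F) :
    -x ∈ connectionSet γ q m ↔ x ∈ connectionSet γ q m := by
  have h1 : θ (-1) = 1 := by
    have h2 : θ (-1) ^ q ^ m = 1 :=
      mulChar_pow_eq_one hγ (by rw [hθ]; exact hξN.pow_eq_one) (neg_ne_zero.mpr one_ne_zero)
    have h3 : θ (-1) ^ 2 = 1 := by rw [← map_pow, neg_one_sq, map_one]
    have h4 := pow_gcd_eq_one.mpr ⟨h2, h3⟩
    rwa [Nat.Coprime.gcd_eq_one (Nat.coprime_two_right.mpr hodd), pow_one] at h4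
  rw [mem_connectionSet_iff hγ hdvd hξN hθ, mem_connectionSet_iff hγ hdvd hξN hθ, neg_ne_zero,
    ← neg_one_mul x, map_mul, h1, one_mul]

end ConnectionSet

/-- The values of the additive character sums over the connection set, for a Gauss sum whose
conjugates are given by the coefficients `C` in the basis of `q`-th roots of unity. -/
lemma sum_addChar_connectionSet {F : Type*} [Field F] [Fintype F] {γ : F} {q m : ℕ} [Fact q.Prime]
    (hm : 1 ≤ m) {ξN ξ : ℂ} {θ : MulChar F ℂ} (hγ : IsPrimitiveRoot γ (Fintype.card F - 1))
    (hdvd : q ^ m ∣ Fintype.card F - 1) (hξN : IsPrimitiveRoot ξN (q ^ m)) (hθ : θ γ = ξN)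
    (hξ : IsPrimitiveRoot ξ q) {ψ : AddChar F ℂ} (hψ : ψ ≠ 1) (C : (ZMod q)ˣ → ℂ)
    (hG : ∀ t, t.Coprime q →
      gaussSum (θ⁻¹ ^ t) ψ = ∑ a : (ZMod q)ˣ, C a * (ξ ^ (a : ZMod q).val) ^ t)
    {b : F} (hb : b ≠ 0) {i₀ : ℕ} (hi₀ : i₀ < q ^ (m - 1)) {u : ZMod q}
    (hu : ∀ i < q ^ (m - 1), ∀ a : ZMod q, θ b * ξN ^ i * ξ ^ a.val = 1 ↔ i = i₀ ∧ a = u) :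
    ∑ x ∈ (connectionSet γ q m).toFinset, ψ (b * x) =
      1 / (q : ℂ) * (-1 - ∑ a : (ZMod q)ˣ, C a) +
        ∑ a : (ZMod q)ˣ, if (a : ZMod q) = u then C a else 0 := by
  have hq : q.Prime := Fact.out
  have hq0 : (q : ℂ) ≠ 0 := by exact_mod_cast hq.ne_zero
  have hθN := mulChar_pow_eq_one hγ (N := q ^ m) (by rw [hθ]; exact hξN.pow_eq_one) hb
  have hshift : ∀ t, ∑ x, (θ⁻¹ ^ t) x * ψ (b * x) = θ b ^ t * gaussSum (θ⁻¹ ^ t) ψ := by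
    intro t
    have h := gaussSum_mulShift_eq (θ⁻¹ ^ t) ψ (Units.mk0 b hb)
    rw [Units.val_mk0, ← inv_pow, inv_inv] at h
    rw [show θ b ^ t = (θ ^ t) b from (MulChar.pow_apply_coe θ t (Units.mk0 b hb)).symm, ← h]
    simp [gaussSum, AddChar.mulShift_apply]
  have hcount : ∀ a : ZMod q, ∑ i ∈ Finset.range (q ^ (m - 1)),
      (if θ b * ξN ^ i * ξ ^ a.val = 1 then (1 : ℂ) else 0) = if a = u then 1 else 0 := by
    intro a
    rw [Finset.sum_eq_single_of_mem i₀ (Finset.mem_range.mpr hi₀)]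
    · simp [hu i₀ hi₀]
    · intro i hi hne
      rw [if_neg]
      rw [hu i (Finset.mem_range.mp hi)]
      exact fun h => hne h.1
  have key := sum_connectionSet hγ hdvd hξN hθ fun x => ψ (b * x)
  have h2 := sum_sum_pow_mul_eq hm hξN hξ hθN C (fun t => gaussSum (θ⁻¹ ^ t) ψ) hG
  -- The term `t = 0` is the Gauss sum of the trivial character, the source of the `-1`.
  simp only [hcount, pow_zero, gaussSum_one_left hψ, mul_ite, mul_one, mul_zero] at h2
  have h3 : (q : ℂ) ^ m * ∑ x ∈ (connectionSet γ q m).toFinset, ψ (b * x) =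
      (q : ℂ) ^ (m - 1) * (-1 - ∑ a : (ZMod q)ˣ, C a) +
        (q : ℂ) ^ m * ∑ a : (ZMod q)ˣ, if (a : ZMod q) = u then C a else 0 := by
    rw [key, ← h2]
    refine Finset.sum_congr rfl fun t _ => Finset.sum_congr rfl fun i _ => ?_
    rw [hshift, mul_pow]
    ring
  refine mul_left_cancel₀ (pow_ne_zero m hq0) ?_
  rw [h3, mul_add]
  congr 1
  nth_rewrite 2 [← Nat.sub_add_cancel hm]
  rw [pow_succ]
  field_simp

/-- A Gauss sum of order `q^m` and all its conjugates in terms of the `q`-th roots of unity. -/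
lemma gaussSum_pow_eq_sum {p : ℕ} [Fact p.Prime] {F : Type*} [Field F] [Fintype F]
    [Algebra (ZMod p) F] {ξp ξ : ℂ} {q m r : ℕ} [Fact q.Prime] (hm : 1 ≤ m)
    (hξp : IsPrimitiveRoot ξp p) (hξ : IsPrimitiveRoot ξ q) {χ : MulChar F ℂ}
    (hχ : ∀ t, t.Coprime q → χ ^ t ≠ 1) (hχN : ∀ x, x ≠ 0 → χ x ^ q ^ m = 1)
    (hχp : ∀ c : (ZMod p)ˣ, χ (algebraMap (ZMod p) F c) = 1) (C : (ZMod q)ˣ → ℤ)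
    (hC : gaussSum χ (canonicalAddChar F hξp.pow_eq_one) =
      (p : ℂ) ^ r * ∑ a : (ZMod q)ˣ, (C a : ℂ) * ξ ^ (a : ZMod q).val) {t : ℕ} (ht : t.Coprime q) :
    gaussSum (χ ^ t) (canonicalAddChar F hξp.pow_eq_one) =
      ∑ a : (ZMod q)ˣ, ((p : ℂ) ^ r * C a) * (ξ ^ (a : ZMod q).val) ^ t := by
  have hχ1 : χ ≠ 1 := by simpa using hχ 1 (Nat.coprime_one_left q)
  obtain ⟨σ, hσ⟩ := exists_algEquiv_pow (ht.pow_right m)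
  have hξN : ξ ^ q ^ m = 1 := by
    rw [← Nat.sub_add_cancel hm, pow_succ', pow_mul, hξ.pow_eq_one, one_pow]
  set x : cyclotomicSubfield (q ^ m) := ⟨ξ, mem_cyclotomicSubfield hξN⟩ with hx
  have hx1 : x ^ q ^ m = 1 := Subtype.ext (by simpa [hx] using hξN)
  have h := algEquiv_gaussSum hξp hχ1 hχN hχp (hχ t ht) σ hσ
    (p ^ r * ∑ a : (ZMod q)ˣ, (C a : cyclotomicSubfield (q ^ m)) * x ^ (a : ZMod q).val)
    (by rw [hC]; simp [hx])
  rw [← h]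
  simp only [map_mul, map_pow, map_natCast, map_sum, map_intCast, hσ x hx1]
  push_cast
  rw [Finset.mul_sum]
  refine Finset.sum_congr rfl fun a _ => ?_
  rw [hx, pow_right_comm ξ t, mul_assoc]

theorem mainTheorem2
    (p p₁ m f w : ℕ) [Fact p.Prime] [Fact p₁.Prime] (hm : 1 ≤ m)
    (hcop : Nat.gcd (p * (p - 1)) (p₁ ^ m) = 1)
    (hneg : (-1 : (ZMod (p₁ ^ m))ˣ) ∉ residueSubgroup (p₁ ^ m) p)
    (hf : f = orderOf (p : ZMod (p₁ ^ m)))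
    (hw : w = (residueSubgroup (p₁ ^ m) p).index)
    (hwdvd : w ∣ p₁ - 1)
    -- the field of order `q = p ^ f` and a primitive element of it
    (F : Type*) [Field F] [Fintype F] [Algebra (ZMod p) F]
    (hF : Fintype.card F = p ^ f)
    (γ : F) (hγ : IsPrimitiveRoot γ (p ^ f - 1))
    -- the choices on which the Gauss sum and the Gauss periods depend
    (ξp ξN ξp₁ : ℂ) (hξp : IsPrimitiveRoot ξp p) (hξN : IsPrimitiveRoot ξN (p₁ ^ m))
    (hξp₁ : IsPrimitiveRoot ξp₁ p₁)
    (g : (ZMod p₁)ˣ) (hg : orderOf g = p₁ - 1)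
    (θ : MulChar F ℂ) (hθ : θ γ = ξN) :
    -- `Cay(F, D)` is an undirected loopless graph, regular of valency `|D|`
    ((∀ x : F, -x ∈ connectionSet γ p₁ m ↔ x ∈ connectionSet γ p₁ m) ∧
      (0 : F) ∉ connectionSet γ p₁ m ∧
      (∀ x y : F, (SimpleGraph.addCayley (connectionSet γ p₁ m)).Adj x y ↔
        x - y ∈ connectionSet γ p₁ m) ∧
      (SimpleGraph.addCayley (connectionSet γ p₁ m)).IsRegularOfDegree
        (connectionSet γ p₁ m).ncard) ∧
    -- it has at most `w + 1` restricted eigenvalues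
    {μ : ℝ | IsRestrictedEigenvalue (SimpleGraph.addCayley (connectionSet γ p₁ m)) μ}.encard
      ≤ w + 1 ∧
    -- their values in terms of the coordinates of the Gauss sum with respect to the Gauss periods
    ∃ r : ℕ,
      IsLargestExponent (p₁ ^ m) p (gaussSum θ⁻¹ (canonicalAddChar F hξp.pow_eq_one)) r ∧
      ∃ c : Fin w → ℤ,
        (∀ c' : Fin w → ℤ,
          gaussSum θ⁻¹ (canonicalAddChar F hξp.pow_eq_one) =
            (p : ℂ) ^ r * ∑ i, (c' i : ℂ) * gaussPeriod p₁ p g ξp₁ i ↔ c' = c) ∧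
        {μ : ℝ | IsRestrictedEigenvalue (SimpleGraph.addCayley (connectionSet γ p₁ m)) μ} =
          {(1 / (p₁ : ℝ)) *
              (-1 + (1 - (p₁ : ℝ)) / (w : ℝ) * (p : ℝ) ^ r * ∑ i, (c i : ℝ))} ∪
          Set.range fun j : Fin w =>
            (1 / (p₁ : ℝ)) *
              (-1 + (1 - (p₁ : ℝ)) / (w : ℝ) * (p : ℝ) ^ r * ∑ i, (c i : ℝ)) +
            (p : ℝ) ^ r * (c j : ℝ) := by
  have hp : p.Prime := Fact.out
  have hq : p₁.Prime := Fact.out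
  have hp0 : (p : ℂ) ≠ 0 := by exact_mod_cast hp.ne_zero
  -- arithmetic of the parameters
  have hcopN : (p * (p - 1)).Coprime (p₁ ^ m) := hcop
  have hpN : p.Coprime (p₁ ^ m) := hcopN.coprime_dvd_left (dvd_mul_right _ _)
  have hp1N : (p - 1).Coprime (p₁ ^ m) := hcopN.coprime_dvd_left (dvd_mul_left _ _)
  have hpq : p.Coprime p₁ := hpN.coprime_dvd_right (dvd_pow_self _ (by omega))
  have hodd : Odd (p₁ ^ m) := by
    refine Nat.coprime_two_left.mp (hcopN.coprime_dvd_left ?_)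
    have := Nat.even_mul_pred_self p
    exact this.two_dvd
  have hdvd : p₁ ^ m ∣ Fintype.card F - 1 := by
    rw [hF]
    refine (Nat.modEq_iff_dvd' (Nat.one_le_pow _ _ hp.pos)).mp ?_
    rw [← ZMod.natCast_eq_natCast_iff]
    simp [hf, pow_orderOf_eq_one]
  rw [← hF] at hγ
  have hw0 : w ≠ 0 := by
    rw [hw]
    exact Subgroup.index_ne_zero_of_finite
  have hwq : w.Coprime p₁ := by
    refine Nat.Coprime.coprime_dvd_left hwdvd (Nat.Coprime.symm ?_)
    rw [Nat.Prime.coprime_iff_not_dvd hq]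
    have := hq.one_lt
    exact Nat.not_dvd_of_pos_of_lt (by omega) (by omega)
  have hwq' : ((residueSubgroup (p₁ ^ m) p).index).Coprime p₁ := hw ▸ hwq
  have hindex : w = (residueSubgroup p₁ p).index := by
    rw [index_residueSubgroup_eq hm hpN hwq', hw]
  have hcardU : Nat.card (ZMod p₁)ˣ = p₁ - 1 := by
    rw [Nat.card_eq_fintype_card, ZMod.card_units_eq_totient, Nat.totient_prime hq]
  obtain ⟨cls, hcls⟩ := exists_coset_index g (hg.trans hcardU.symm) (residueSubgroup p₁ p) hindex
  -- the graph
  have hnegD := neg_mem_connectionSet_iff hγ hdvd hξN hθ hodd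
  have h0D : (0 : F) ∉ connectionSet γ p₁ m := fun h =>
    ((mem_connectionSet_iff hγ hdvd hξN hθ 0).mp h).1 rfl
  refine ⟨⟨hnegD, h0D, addCayley_adj_iff_sub_mem hnegD h0D,
    isRegularOfDegree_addCayley hnegD h0D⟩, ?_⟩
  -- the character
  have hγ0 : γ ≠ 0 := by
    have := Fintype.one_lt_card (α := F)
    exact hγ.ne_zero (by omega)
  have hθinv : ∀ x, θ⁻¹ x = (θ x)⁻¹ := fun x => by
    rw [MulChar.inv_apply_eq_inv, Ring.inverse_eq_inv']
  have hθN : ∀ x, x ≠ 0 → θ x ^ p₁ ^ m = 1 := fun x hx =>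
    mulChar_pow_eq_one hγ (by rw [hθ]; exact hξN.pow_eq_one) hx
  have hχN : ∀ x, x ≠ 0 → θ⁻¹ x ^ p₁ ^ m = 1 := fun x hx => by
    rw [hθinv, inv_pow, hθN x hx, inv_one]
  have hχ : ∀ t, t.Coprime p₁ → θ⁻¹ ^ t ≠ 1 := by
    intro t ht h
    have h1 := DFunLike.congr_fun h γ
    rw [MulChar.one_apply (isUnit_iff_ne_zero.mpr hγ0)] at h1
    have ht0 : t ≠ 0 := by
      rintro rfl
      exact hq.one_lt.ne' (by simpa using ht)
    rw [MulChar.pow_apply' _ ht0, hθinv, hθ, inv_pow, inv_eq_one, hξN.pow_eq_one_iff_dvd] at h1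
    exact hq.one_lt.ne' (Nat.dvd_one.mp
      (ht.gcd_eq_one ▸ Nat.dvd_gcd ((dvd_pow_self p₁ (by omega)).trans h1) dvd_rfl))
  have hχ1 : θ⁻¹ ≠ 1 := by simpa using hχ 1 (Nat.coprime_one_left _)
  have hχp : ∀ c : (ZMod p)ˣ, θ⁻¹ (algebraMap (ZMod p) F c) = 1 := by
    -- The value is killed by both `p - 1` and `p₁ ^ m`, which are coprime.
    intro c
    have h1 : θ⁻¹ (algebraMap (ZMod p) F c) ^ (p - 1) = 1 := by
      rw [← map_pow, ← map_pow, ← Units.val_pow_eq_pow_val, ZMod.units_pow_card_sub_one_eq_one]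
      simp
    have h2 := hχN (algebraMap (ZMod p) F c) (by simp)
    have h3 := pow_gcd_eq_one.mpr ⟨h1, h2⟩
    rwa [hp1N.gcd_eq_one, pow_one] at h3
  set ψ : AddChar F ℂ := canonicalAddChar F hξp.pow_eq_one with hψ
  have hψprim : ψ.IsPrimitive := canonicalAddChar_isPrimitive hξp
  have hψ1 : ψ ≠ 1 := by simpa using hψprim one_ne_zero
  -- the coordinates
  obtain ⟨r, hr⟩ := exists_isLargestExponent hξp hχ1 hχN hχp (hχ p hpq) hF
  obtain ⟨C, hCinv, hC⟩ := exists_invariant_unit_coeff hm hpN hwq' hξp₁ hr.1.1 hr.1.2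
  set c : Fin w → ℤ := fun j => C (g ^ (j : ℕ)) with hc
  have hCc : ∀ a, C a = c (cls a) := by
    intro a
    obtain ⟨h, hh, ha⟩ := (hcls a (cls a)).mpr rfl
    rw [hc]
    nth_rewrite 1 [ha]
    rw [mul_comm, hCinv h hh]
  have hgC : gaussSum θ⁻¹ ψ =
      (p : ℂ) ^ r * ∑ a : (ZMod p₁)ˣ, (C a : ℂ) * ξp₁ ^ (a : ZMod p₁).val := by
    rw [← hC, mul_div_cancel₀ _ (pow_ne_zero r hp0)]
  have hsurj : ∀ j : Fin w, cls (g ^ (j : ℕ)) = j := fun j =>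
    (hcls _ j).mp ⟨1, one_mem _, (mul_one _).symm⟩
  have huniq : ∀ c' : Fin w → ℤ, gaussSum θ⁻¹ ψ =
      (p : ℂ) ^ r * ∑ i, (c' i : ℂ) * gaussPeriod p₁ p g ξp₁ i ↔ c' = c := by
    intro c'
    rw [hgC, sum_mul_gaussPeriod ξp₁ hcls]
    constructor
    · intro h
      have h1 := mul_left_cancel₀ (pow_ne_zero r hp0) h
      rw [← sub_eq_zero, ← Finset.sum_sub_distrib] at h1
      simp only [← sub_mul, ← Int.cast_sub] at h1
      have h2 := unit_coeff_eq_zero_of_sum_eq_zero hξp₁ (fun a => C a - c' (cls a)) h1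
      funext j
      have h3 := congrFun h2 (g ^ (j : ℕ))
      simp only [hsurj, Pi.zero_apply] at h3
      simp only [hc]
      omega
    · rintro rfl
      simp only [hCc]
  -- the eigenvalues
  have hsumC : ∑ a : (ZMod p₁)ˣ, (C a : ℂ) = ((p₁ : ℂ) - 1) / w * ∑ j, (c j : ℂ) := by
    have hcard : (w : ℂ) * (Nat.card (residueSubgroup p₁ p) : ℂ) = (p₁ : ℂ) - 1 := by
      rw [hindex, ← Nat.cast_mul, Subgroup.index_mul_card, hcardU, Nat.cast_sub hq.one_le,
        Nat.cast_one]
    rw [← Finset.sum_fiberwise Finset.univ cls, Finset.mul_sum]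
    refine Finset.sum_congr rfl fun j _ => ?_
    rw [Finset.sum_congr rfl (g := fun _ => (c j : ℂ)) (fun a ha => by
      rw [hCc, (Finset.mem_filter.mp ha).2]), Finset.sum_const, card_coset_fiber hcls, nsmul_eq_mul,
      ← hcard, mul_div_cancel_left₀ _ (by exact_mod_cast hw0)]
  set base : ℝ := (1 / (p₁ : ℝ)) *
    (-1 + (1 - (p₁ : ℝ)) / (w : ℝ) * (p : ℝ) ^ r * ∑ i, (c i : ℝ)) with hbase
  have hvalue : ∀ b : F, b ≠ 0 → ∀ i₀ < p₁ ^ (m - 1), ∀ u : ZMod p₁,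
      (∀ i < p₁ ^ (m - 1), ∀ a : ZMod p₁,
        θ b * ξN ^ i * ξp₁ ^ a.val = 1 ↔ i = i₀ ∧ a = u) →
      ∑ x ∈ (connectionSet γ p₁ m).toFinset, ψ (b * x) = (base : ℂ) +
        ∑ a : (ZMod p₁)ˣ, if (a : ZMod p₁) = u then (p : ℂ) ^ r * C a else 0 := by
    intro b hb i₀ hi₀ u hu
    rw [sum_addChar_connectionSet hm hγ hdvd hξN hθ hξp₁ hψ1 (fun a => (p : ℂ) ^ r * C a)
      (fun t ht => gaussSum_pow_eq_sum hm hξp hξp₁ hχ hχN hχp C hgC ht) hb hi₀ hu,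
      ← Finset.mul_sum, hsumC, hbase]
    push_cast
    ring
  -- No unit equals 0, so `u = 0` yields the bare `base`: the one eigenvalue not attached to a
  -- coset.
  have hvalue_zero : ∑ a : (ZMod p₁)ˣ,
      (if (a : ZMod p₁) = 0 then (p : ℂ) ^ r * C a else 0) = 0 :=
    Finset.sum_eq_zero fun a _ => if_neg a.ne_zero
  have hvalue_unit : ∀ v : (ZMod p₁)ˣ, ∑ a : (ZMod p₁)ˣ,
      (if (a : ZMod p₁) = v then (p : ℂ) ^ r * C a else 0) = (p : ℂ) ^ r * c (cls v) := by
    intro v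
    simp only [Units.val_inj]
    rw [Finset.sum_ite_eq' Finset.univ v, if_pos (Finset.mem_univ v), hCc]
  have hattain : ∀ u : ZMod p₁, ∃ b : F, b ≠ 0 ∧
      ∑ x ∈ (connectionSet γ p₁ m).toFinset, ψ (b * x) = (base : ℂ) +
        ∑ a : (ZMod p₁)ˣ, if (a : ZMod p₁) = u then (p : ℂ) ^ r * C a else 0 := by
    intro u
    -- Choosing `b` with `θ b` inverse to `ξp₁ ^ u` makes `(0, u)` the selected pair.
    have hx : ((ξp₁ ^ u.val)⁻¹) ^ p₁ ^ m = 1 := by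
      rw [inv_pow, pow_right_comm, ← Nat.sub_add_cancel hm, pow_succ', pow_mul, hξp₁.pow_eq_one,
        one_pow, one_pow, inv_one]
    obtain ⟨k, -, hk⟩ := hξN.eq_pow_of_pow_eq_one hx
    have hb : θ (γ ^ k) = (ξp₁ ^ u.val)⁻¹ := by rw [map_pow, hθ, hk]
    refine ⟨γ ^ k, pow_ne_zero _ hγ0, ?_⟩
    obtain ⟨i₀, hi₀, u', hu'⟩ := exists_unique_root_relation hm hξN hξp₁
      (hθN (γ ^ k) (pow_ne_zero _ hγ0))
    have huu : u = u' := by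
      refine ((hu' 0 (pow_pos hq.pos _) u).mp ?_).2
      rw [hb, pow_zero, mul_one, inv_mul_cancel₀ (pow_ne_zero _ (hξp₁.ne_zero hq.ne_zero))]
    rw [huu]
    exact hvalue _ (pow_ne_zero _ hγ0) i₀ hi₀ u' hu'
  have hset : {μ : ℝ | IsRestrictedEigenvalue
      (SimpleGraph.addCayley (connectionSet γ p₁ m)) μ} =
      {base} ∪ Set.range fun j : Fin w => base + (p : ℝ) ^ r * (c j : ℝ) := by
    ext μ
    rw [Set.mem_ofPred_eq, isRestrictedEigenvalue_addCayley_iff hψprim hnegD h0D]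
    constructor
    · rintro ⟨b, hb, hμ⟩
      obtain ⟨i₀, hi₀, u, hu⟩ := exists_unique_root_relation hm hξN hξp₁ (hθN b hb)
      rw [hvalue b hb i₀ hi₀ u hu] at hμ
      by_cases hu0 : u = 0
      · left
        rw [hu0, hvalue_zero, add_zero] at hμ
        exact Complex.ofReal_injective hμ
      · right
        have h1 := hvalue_unit (Units.mk0 u hu0)
        rw [Units.val_mk0] at h1
        rw [h1] at hμ
        refine ⟨cls (Units.mk0 u hu0), Complex.ofReal_injective ?_⟩
        rw [hμ]
        push_cast
        rfl
    · rintro (h | ⟨j, h⟩)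
      · obtain ⟨b, hb, hval⟩ := hattain 0
        refine ⟨b, hb, ?_⟩
        rw [hval, hvalue_zero, add_zero, Set.mem_singleton_iff.mp h]
      · obtain ⟨b, hb, hval⟩ := hattain ((g ^ (j : ℕ) : (ZMod p₁)ˣ) : ZMod p₁)
        refine ⟨b, hb, ?_⟩
        rw [hval, hvalue_unit, hsurj, ← h]
        push_cast
        rfl
  refine ⟨?_, r, hr, c, huniq, hset⟩
  rw [hset]
  refine (Set.encard_union_le _ _).trans ?_
  rw [Set.encard_singleton, add_comm]
  gcongr
  rw [← Set.image_univ]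
  refine (Set.encard_image_le _ _).trans ?_
  simp
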